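/- Let $L^1[0,1)$ be the space of (classes of) complex-valued Lebesgue integrable functions on $[0,1)$ with norm $\|f\|=\int_0^1|f(t)|\,dt$, and let $M[0,1)$ be the space of finite complex Borel measures on $[0,1)$ with the total variation norm. Let $\mu$ be a complex Borel measure on $[0,1)$, finite on compact sets (that is, a countably additive complex set function on the Borel sets contained in some $[0,a]$ with $a<1$), with total variation $|\mu|$, and suppose that $t\,|\mu|([0,1-t))$ is bounded as $t\to0_+$. Then the formulas $$(D_\mu f)(t)=(Xf*\mu)(t)=\int_{[0,t]}(t-s)f(t-s)\,d\mu(s)\qquad(f\in L^1[0,1),\ \text{a.e. } t\in[0,1)),$$ $$(\overline{D}_\mu\nu)(E)=(X\nu*\mu)(E)=\int_{[0,1)}\mu(\{s\in[0,1):s+t\in E\})\,t\,d\nu(t)\qquad(\nu\in M[0,1),\ E\subseteq[0,1)\text{ Borel}),$$ whose integrals converge absolutely (the second integrand being $0$ at $t=0$), define bounded linear operators $D_\mu$ on $L^1[0,1)$ and $\overline{D}_\mu$ on $M[0,1)$, and the following conditions are equivalent: (a) $D_\mu$ is compact on $L^1[0,1)$. (b) $D_\mu$ is weakly compact on $L^1[0,1)$.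 (c) $\mu$ is absolutely continuous with respect to Lebesgue measure and $t\,|\mu|([0,1-t))\to0$ as $t\to0_+$. (d) $\overline{D}_\mu$ is compact on $M[0,1)$. (e) $\overline{D}_\mu$ is weakly compact on $M[0,1)$. -/

import Mathlib

open MeasureTheory Filter Topology Set
open scoped ENNReal

/-! ### The interval `[0,1)` and the measure algebra `M[0,1)` as a normed space -/

/-- The half-open interval `[0,1)`. -/
abbrev UnitIco : Type := Set.Ico (0 : ℝ) 1

/-- Lebesgue measure on `[0,1)`. -/
noncomputable instance UnitIco.instMeasureSpace : MeasureSpace UnitIco :=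
  Measure.Subtype.measureSpace

/-- A complex measure has finite total variation. -/
theorem MeasureTheory.ComplexMeasure.variation_lt_top {α : Type*} [MeasurableSpace α] (ν : ComplexMeasure α) :
    ν.variation Set.univ < ∞ := by
  have hle : ν.variation ≤ (ComplexMeasure.re ν).totalVariation
      + (ComplexMeasure.im ν).totalVariation := by
    refine VectorMeasure.variation_le_of_forall_enorm_le fun E _ => ?_
    calc ‖ν E‖ₑ = ‖((ν E).re : ℂ) + ((ν E).im : ℂ) * Complex.I‖ₑ := by rw [Complex.re_add_im]
      _ ≤ ‖((ν E).re : ℂ)‖ₑ + ‖((ν E).im : ℂ) * Complex.I‖ₑ := enorm_add_le _ _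
      _ = ‖ComplexMeasure.re ν E‖ₑ + ‖ComplexMeasure.im ν E‖ₑ := by
        congr 1
        · change ‖((ν E).re : ℂ)‖ₑ = ‖(ν E).re‖ₑ
          simp [enorm_eq_nnnorm]
        · change ‖((ν E).im : ℂ) * Complex.I‖ₑ = ‖(ν E).im‖ₑ
          simp [enorm_eq_nnnorm]
      _ ≤ _ := by
        rw [Measure.add_apply]
        exact add_le_add (SignedMeasure.enorm_le_totalVariation _ _)
          (SignedMeasure.enorm_le_totalVariation _ _)
  exact lt_of_le_of_lt (hle Set.univ) (measure_lt_top _ _)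

/-- The total variation norm `‖ν‖ = |ν|(α)` makes the complex measures on `α` a normed group. -/
noncomputable instance MeasureTheory.ComplexMeasure.instNormedAddCommGroup {α : Type*} [MeasurableSpace α] :
    NormedAddCommGroup (ComplexMeasure α) :=
  AddGroupNorm.toNormedAddCommGroup
    { toFun := fun ν => (ν.variation Set.univ).toReal
      map_zero' := by simp
      add_le' := fun ν ρ => by
        rw [← ENNReal.toReal_add (ComplexMeasure.variation_lt_top ν).ne (ComplexMeasure.variation_lt_top ρ).ne]
        refine ENNReal.toReal_mono
          (ENNReal.add_lt_top.2 ⟨(ComplexMeasure.variation_lt_top ν), (ComplexMeasure.variation_lt_top ρ)⟩).ne ?_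
        exact VectorMeasure.variation_add_le Set.univ
      neg' := fun ν => by rw [VectorMeasure.variation_neg]
      eq_zero_of_map_eq_zero' := fun ν h => by
        rw [ENNReal.toReal_eq_zero_iff] at h
        rcases h with h | h
        · exact VectorMeasure.variation_eq_zero.1 (Measure.measure_univ_eq_zero.1 h)
        · exact absurd h (ComplexMeasure.variation_lt_top ν).ne }

theorem MeasureTheory.ComplexMeasure.norm_eq {α : Type*} [MeasurableSpace α] (ν : ComplexMeasure α) :
    ‖ν‖ = (ν.variation Set.univ).toReal := rfl

noncomputable instance MeasureTheory.ComplexMeasure.instNormedSpace {α : Type*} [MeasurableSpace α] :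
    NormedSpace ℂ (ComplexMeasure α) where
  norm_smul_le c ν := by
    rw [ComplexMeasure.norm_eq, ComplexMeasure.norm_eq, VectorMeasure.variation_smul]
    simp

/-- The Volterra space `L¹[0,1)`, with norm `‖f‖ = ∫₀¹ |f(t)| dt`. -/
abbrev VolterraL1 : Type := Lp ℂ 1 (volume : Measure UnitIco)

/-- The space `M[0,1)` of finite complex Borel measures on `[0,1)`, with the variation norm. -/
abbrev VolterraM : Type := ComplexMeasure UnitIco

/-! ### Locally finite complex Borel measures on `[0,1)` -/

/-- A complex Borel measure on `[0,1)` that is finite on compact sets, but possibly of infinite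
total variation: a countably additive complex function on the Borel sets contained in some `[0,a]`
with `a < 1`. (In the order of `[0,1)` such sets are precisely the ones bounded above.) On all other
sets the value is set to `0` by convention. -/
structure LocalComplexMeasure where
  measureOf : Set UnitIco → ℂ
  junk' : ∀ s : Set UnitIco, ¬ (MeasurableSet s ∧ BddAbove s) → measureOf s = 0
  iUnion' : ∀ s : ℕ → Set UnitIco, (∀ n, MeasurableSet (s n)) →
    Pairwise (Function.onFun Disjoint s) → BddAbove (⋃ n, s n) →
    HasSum (fun n => measureOf (s n)) (measureOf (⋃ n, s n))

namespace LocalComplexMeasure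

theorem measureOf_empty (μ : LocalComplexMeasure) : μ.measureOf ∅ = 0 := by
  have h := μ.iUnion' (fun _ => ∅) (fun _ => MeasurableSet.empty)
    (fun _ _ _ => disjoint_bot_left) (by simp)
  exact tendsto_nhds_unique tendsto_const_nhds h.summable.tendsto_atTop_zero

open Classical in
/-- The restriction of `μ` to a Borel set `K ⊆ [0,a]`, `a < 1`: the finite complex measure
`A ↦ μ (A ∩ K)`. -/
noncomputable def restr (μ : LocalComplexMeasure) (K : Set UnitIco) : ComplexMeasure UnitIco where
  measureOf' A := if MeasurableSet A ∧ MeasurableSet K ∧ BddAbove K then μ.measureOf (A ∩ K) else 0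
  empty' := by simp [μ.measureOf_empty]
  not_measurable' A hA := by simp [hA]
  m_iUnion' s hs hd := by
    by_cases hK : MeasurableSet K ∧ BddAbove K
    · have hU : MeasurableSet (⋃ n, s n) := MeasurableSet.iUnion hs
      simp only [hs, hK, hU, and_self, if_true, Set.iUnion_inter]
      refine μ.iUnion' _ (fun n => (hs n).inter hK.1)
        (fun i j hij => (hd hij).mono Set.inter_subset_left Set.inter_subset_left) ?_
      exact hK.2.mono (Set.iUnion_subset fun n => Set.inter_subset_right)
    · simp only [hK, and_false, if_false]
      exact hasSum_zero

/-- `|μ|(K)`, the total variation of `μ` on a Borel set `K ⊆ [0,a]`, `a < 1`. -/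
noncomputable def totalVar (μ : LocalComplexMeasure) (K : Set UnitIco) : ℝ≥0∞ :=
  (μ.restr K).variation Set.univ

/-- The function `t ↦ t |μ|([0,1-t))` for `t > 0`. -/
noncomputable def tailFun (μ : LocalComplexMeasure) (t : ℝ) : ℝ≥0∞ :=
  ENNReal.ofReal t * μ.totalVar {s : UnitIco | (s : ℝ) < 1 - t}

/-- `t |μ|([0,1-t))` is bounded as `t → 0+`. -/
def TailBounded (μ : LocalComplexMeasure) : Prop :=
  ∃ C : ℝ, ∀ᶠ t : ℝ in 𝓝[>] 0, μ.tailFun t ≤ ENNReal.ofReal C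

/-- `μ` is absolutely continuous with respect to Lebesgue measure. -/
def IsAbsolutelyContinuous (μ : LocalComplexMeasure) : Prop :=
  ∀ A : Set UnitIco, MeasurableSet A → BddAbove A → volume A = 0 → μ.measureOf A = 0

end LocalComplexMeasure

/-! ### The operators `D_μ f = Xf * μ` and `D̄_μ ν = Xν * μ` -/

/-- The truncated difference `max (t - s) 0` on `[0,1)`; only the case `s ≤ t` matters, where it is
`t - s`. -/
noncomputable def UnitIco.tsub (t s : UnitIco) : UnitIco :=
  ⟨max ((t : ℝ) - s) 0, le_max_right _ _,
    max_lt (by linarith [t.2.2, s.2.1]) one_pos⟩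

/-- The translate `(E - t) ∩ [0,1) = {s ∈ [0,1) : s + t ∈ E}` of a set `E ⊆ [0,1)`. It is contained
in `[0,1-t)`. -/
def UnitIco.shift (t : UnitIco) (E : Set UnitIco) : Set UnitIco :=
  {s | ∃ x ∈ E, (x : ℝ) = s + t}

/-- `D` is the operator `D_μ f = Xf * μ` on `L¹[0,1)`, `(Xf)(t) = t f(t)`: for every `f` and almost
every `t`, the integral in `(Xf * μ)(t) = ∫_{[0,t]} (t - s) f(t - s) dμ(s)` converges absolutely and
equals `(D f)(t)`. -/
def IsVolterraDerivation (μ : LocalComplexMeasure) (D : VolterraL1 →L[ℂ] VolterraL1) : Prop :=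
  ∀ f : VolterraL1, ∀ᵐ t : UnitIco,
    (μ.restr (Set.Iic t)).Integrable
      (fun s : UnitIco => ((UnitIco.tsub t s : ℝ) : ℂ) * f (UnitIco.tsub t s)) ∧
    D f t = (μ.restr (Set.Iic t)).integral
      (fun s : UnitIco => ((UnitIco.tsub t s : ℝ) : ℂ) * f (UnitIco.tsub t s))
      (ContinuousLinearMap.mul ℝ ℂ)

/-- `D` is the operator `D̄_μ ν = Xν * μ` on `M[0,1)`, `d(Xν)(t) = t dν(t)`: for every `ν` and every
Borel set `E ⊆ [0,1)`, the integral in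
`(Xν * μ)(E) = ∫_{[0,1)} μ({s : s + t ∈ E}) t dν(t)` converges absolutely and equals `(D ν)(E)`. -/
def IsVolterraMeasureDerivation (μ : LocalComplexMeasure) (D : VolterraM →L[ℂ] VolterraM) : Prop :=
  ∀ ν : VolterraM, ∀ E : Set UnitIco, MeasurableSet E →
    ν.Integrable (fun t : UnitIco => ((t : ℝ) : ℂ) * μ.measureOf (UnitIco.shift t E)) ∧
    D ν E = ν.integral
      (fun t : UnitIco => ((t : ℝ) : ℂ) * μ.measureOf (UnitIco.shift t E))
      (ContinuousLinearMap.mul ℝ ℂ)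

/-- The formula for `D_μ` determines the operator. -/
theorem IsVolterraDerivation.unique {μ : LocalComplexMeasure} {D D' : VolterraL1 →L[ℂ] VolterraL1}
    (h : IsVolterraDerivation μ D) (h' : IsVolterraDerivation μ D') : D = D' := by
  refine ContinuousLinearMap.ext fun f => Lp.ext ?_
  filter_upwards [h f, h' f] with t ht ht'
  rw [ht.2, ht'.2]

/-- The formula for `D̄_μ` determines the operator. -/
theorem IsVolterraMeasureDerivation.unique {μ : LocalComplexMeasure}
    {D D' : VolterraM →L[ℂ] VolterraM}
    (h : IsVolterraMeasureDerivation μ D) (h' : IsVolterraMeasureDerivation μ D') : D = D' := by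
  refine ContinuousLinearMap.ext fun ν => VectorMeasure.ext fun E hE => ?_
  rw [(h ν E hE).2, (h' ν E hE).2]

/-- A bounded operator is weakly compact if it maps the closed unit ball to a relatively weakly
compact set. -/
def IsWeaklyCompactOperator {E F : Type*} [NormedAddCommGroup E] [NormedSpace ℂ E]
    [NormedAddCommGroup F] [NormedSpace ℂ F] (T : E →L[ℂ] F) : Prop :=
  IsCompact (closure (toWeakSpace ℂ F '' (T '' Metric.closedBall (0 : E) 1)))

/-! ### Complex measures: polar decomposition, densities and integrals -/

/-! Everything is read off from the measures `μ.pointConv t` $= t\,(\delta_t*\mu)$, the images of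
the point masses: $\overline D_\mu\nu=\int t(\delta_t*\mu)\,d\nu(t)$. The norm of $t(\delta_t*\mu)$
is $t|\mu|([0,1-t))$, so the tail bound makes $\overline D_\mu$ bounded. By Fubini and translation
invariance $\overline D_\mu$ maps $L^1$ into $L^1$, where it is $D_\mu$. Polar decompositions of
$\nu$ and of $\mu$ turn all these integrals into integrals against positive measures.

Necessity of (c). Both (b) and (e) make $\overline D_\mu$ weakly compact as a map from $L^1$ to $M$.
The images of the normalized indicators of $[a,b)$ have, along an ultrafilter with $b\downarrow a$,
a weak limit, which is $a(\delta_a*\mu)$ because $t\mapsto t\mu([0,x-t))$ is right-continuous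
(`pointConv_mem_closure`). These images are absolutely continuous and evaluation on a null set is
weakly continuous, so $a(\delta_a*\mu)$, and with it $\mu$, is absolutely continuous. Moreover all
$a(\delta_a*\mu)$ lie in one weakly compact set, and their variation on $[0,r)$, $r<1$, tends to $0$
as $a\to0$. Hence $0$ is their only weak cluster point and they tend to $0$ on every Borel set. A
gliding hump (`tendsto_enorm_of_tendsto_apply`) upgrades this to norm convergence, which is the
vanishing of the tail.

Sufficiency of (c). If $\mu$ has density $d$, then $t\mapsto t\,d(\cdot-t)$ is continuous into $L^1$
and tends to $0$ at both ends of $[0,1)$, so its range is totally bounded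
(`exists_continuous_pointConv`). For $\|\nu\|\le1$ the integral $\overline D_\mu\nu$ lies in the
closed convex hull of a compact set, which is compact by Mazur's theorem. Compactness of $D_\mu$
follows by restriction to $L^1$. -/

namespace MeasureTheory.ComplexMeasure

variable {α : Type*} [MeasurableSpace α]

instance isFiniteMeasure_variation (ν : ComplexMeasure α) : IsFiniteMeasure ν.variation :=
  ⟨ν.variation_lt_top⟩

theorem enorm_eq (ν : ComplexMeasure α) : ‖ν‖ₑ = ν.variation univ := by
  rw [← ofReal_norm, norm_eq, ENNReal.ofReal_toReal ν.variation_lt_top.ne]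

theorem norm_apply_le (ν : ComplexMeasure α) (E : Set α) : ‖ν E‖ ≤ ‖ν‖ := by
  refine (VectorMeasure.norm_measure_le_variation (measure_ne_top _ _)).trans ?_
  rw [norm_eq]
  exact ENNReal.toReal_mono (measure_ne_top _ _) (measure_mono (subset_univ _))

/-- Evaluation of a complex measure on a set, as a bounded functional. -/
noncomputable def evalCLM (E : Set α) : ComplexMeasure α →L[ℂ] ℂ :=
  LinearMap.mkContinuous
    { toFun := fun ν => ν E
      map_add' := fun ν ρ => _root_.add_apply ν ρ E
      map_smul' := fun c ν => rfl } 1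
    fun ν => by simpa using norm_apply_le ν E

@[simp]
theorem evalCLM_apply (E : Set α) (ν : ComplexMeasure α) : evalCLM E ν = ν E := rfl

theorem variation_le_re_add_im (ν : ComplexMeasure α) :
    ν.variation ≤ (re ν).variation + (im ν).variation := by
  refine VectorMeasure.variation_le_of_forall_enorm_le fun E _ => ?_
  have hr : ‖((ν E).re : ℂ)‖ₑ = ‖re ν E‖ₑ := by
    change ‖((ν E).re : ℂ)‖ₑ = ‖(ν E).re‖ₑ
    simp [enorm_eq_nnnorm]
  have hi : ‖((ν E).im : ℂ) * Complex.I‖ₑ = ‖im ν E‖ₑ := by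
    change ‖((ν E).im : ℂ) * Complex.I‖ₑ = ‖(ν E).im‖ₑ
    simp [enorm_eq_nnnorm]
  calc ‖ν E‖ₑ = ‖((ν E).re : ℂ) + ((ν E).im : ℂ) * Complex.I‖ₑ := by rw [Complex.re_add_im]
    _ ≤ ‖((ν E).re : ℂ)‖ₑ + ‖((ν E).im : ℂ) * Complex.I‖ₑ := enorm_add_le _ _
    _ = ‖re ν E‖ₑ + ‖im ν E‖ₑ := by rw [hr, hi]
    _ ≤ _ := by
      rw [Measure.add_apply]
      exact add_le_add (VectorMeasure.enorm_measure_le_variation _ _)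
        (VectorMeasure.enorm_measure_le_variation _ _)

theorem enorm_re_apply_le (ν : ComplexMeasure α) (E : Set α) : ‖re ν E‖ₑ ≤ ‖ν E‖ₑ := by
  change ‖(ν E).re‖ₑ ≤ ‖ν E‖ₑ
  rw [enorm_le_iff_norm_le]
  exact Complex.abs_re_le_norm _

theorem enorm_im_apply_le (ν : ComplexMeasure α) (E : Set α) : ‖im ν E‖ₑ ≤ ‖ν E‖ₑ := by
  change ‖(ν E).im‖ₑ ≤ ‖ν E‖ₑ
  rw [enorm_le_iff_norm_le]
  exact Complex.abs_im_le_norm _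

/-- The total variation is attained by the modulus of the measure of a single subset, up to a
factor of `4`. -/
theorem exists_subset_lt_enorm_apply (ν : ComplexMeasure α) {s : Set α} (hs : MeasurableSet s)
    {a : ℝ≥0∞} (ha : a < ν.variation s) : ∃ t ⊆ s, MeasurableSet t ∧ a < 4 * ‖ν t‖ₑ := by
  have h : a < (re ν).variation s + (im ν).variation s :=
    ha.trans_le (by simpa using ν.variation_le_re_add_im s)
  -- The factor 4 is 2 for the choice between real and imaginary part times 2 from the signed case.
  have h2 : a / 2 < (re ν).variation s ∨ a / 2 < (im ν).variation s := by
    by_contra! hc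
    exact absurd (add_le_add hc.1 hc.2) (by rw [ENNReal.add_halves]; exact not_le.2 h)
  have key : ∀ x : ℝ≥0∞, a / 2 < 2 * x → a < 4 * x := fun x hx => by
    have := ENNReal.mul_lt_mul_right (a := 2) (by simp) (by simp) hx
    rwa [ENNReal.mul_div_cancel (by simp) (by simp), ← mul_assoc, show (2 : ℝ≥0∞) * 2 = 4 by norm_num]
      at this
  rcases h2 with h2 | h2
  · obtain ⟨t, hts, ht, hlt⟩ := SignedMeasure.exists_subset_lt_enorm_apply_of_lt_variation _ hs h2
    exact ⟨t, hts, ht, (key _ hlt).trans_le (by gcongr; exact enorm_re_apply_le ν t)⟩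
  · obtain ⟨t, hts, ht, hlt⟩ := SignedMeasure.exists_subset_lt_enorm_apply_of_lt_variation _ hs h2
    exact ⟨t, hts, ht, (key _ hlt).trans_le (by gcongr; exact enorm_im_apply_le ν t)⟩

theorem withDensityᵥ_rnDeriv_eq (ν : ComplexMeasure α) (m : Measure α) [SigmaFinite m]
    (h : ν.variation ≪ m) : m.withDensityᵥ (ν.rnDeriv m) = ν := by
  have hz : ∀ E, MeasurableSet E → m E = 0 → ν E = 0 := fun E hE h0 => by
    have := VectorMeasure.enorm_measure_le_variation ν E
    rwa [h h0, nonpos_iff_eq_zero, enorm_eq_zero] at this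
  have hre : (re ν) ≪ᵥ m.toENNRealVectorMeasure := by
    refine VectorMeasure.AbsolutelyContinuous.mk fun E hE h0 => ?_
    rw [Measure.toENNRealVectorMeasure_apply_measurable hE] at h0
    change (ν E).re = 0
    rw [hz E hE h0, Complex.zero_re]
  have him : (im ν) ≪ᵥ m.toENNRealVectorMeasure := by
    refine VectorMeasure.AbsolutelyContinuous.mk fun E hE h0 => ?_
    rw [Measure.toENNRealVectorMeasure_apply_measurable hE] at h0
    change (ν E).im = 0
    rw [hz E hE h0, Complex.zero_im]
  ext E hE : 1
  rw [withDensityᵥ_apply (ν.integrable_rnDeriv m) hE]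
  have hi := (ν.integrable_rnDeriv m).integrableOn (s := E)
  apply Complex.ext
  · rw [← RCLike.re_eq_complex_re, ← integral_re hi]
    have h1 := congrArg (fun ρ => ρ E) (SignedMeasure.withDensityᵥ_rnDeriv_eq _ m hre)
    rw [withDensityᵥ_apply (SignedMeasure.integrable_rnDeriv _ _) hE] at h1
    exact h1
  · rw [← RCLike.im_eq_complex_im, ← integral_im hi]
    have h1 := congrArg (fun ρ => ρ E) (SignedMeasure.withDensityᵥ_rnDeriv_eq _ m him)
    rw [withDensityᵥ_apply (SignedMeasure.integrable_rnDeriv _ _) hE] at h1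
    exact h1

theorem measurable_rnDeriv (ν : ComplexMeasure α) (m : Measure α) : Measurable (ν.rnDeriv m) :=
  Complex.measurableEquivRealProd.symm.measurable.comp
    ((SignedMeasure.measurable_rnDeriv _ _).prodMk (SignedMeasure.measurable_rnDeriv _ _))

/-- The polar decomposition of a complex measure. -/
theorem exists_polar (ν : ComplexMeasure α) :
    ∃ k : α → ℂ, Measurable k ∧ (∀ x, ‖k x‖ = 1) ∧ ν.variation.withDensityᵥ k = ν := by
  set g := ν.rnDeriv ν.variation with hg
  have hgi : Integrable g ν.variation := ν.integrable_rnDeriv _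
  have hgm : Measurable g := ν.measurable_rnDeriv _
  have hν : ν.variation.withDensityᵥ g = ν :=
    ν.withDensityᵥ_rnDeriv_eq _ Measure.AbsolutelyContinuous.rfl
  -- The variation of $g|\nu|$ is $|g|\,|\nu|$, and here it is $|\nu|$ itself. Below, `g` is
  -- replaced by `1` on the exceptional null set.
  have h1 : ∀ᵐ x ∂ν.variation, ‖g x‖ₑ = 1 := by
    have h := Measure.variation_withDensityᵥ hgi
    rw [hν] at h
    have h' : ν.variation.withDensity (fun _ => 1) = ν.variation.withDensity (fun x => ‖g x‖ₑ) := by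
      rw [← h]; exact withDensity_one
    have := (withDensity_eq_iff aemeasurable_const hgm.enorm.aemeasurable
      (by simp)).1 h'
    filter_upwards [this] with x hx using hx.symm
  have hs : MeasurableSet {x | ‖g x‖ = 1} := measurableSet_eq_fun hgm.norm measurable_const
  classical
  refine ⟨fun x => if ‖g x‖ = 1 then g x else 1, Measurable.ite hs hgm measurable_const, ?_, ?_⟩
  · intro x
    by_cases hx : ‖g x‖ = 1 <;> simp [hx]
  · conv_rhs => rw [← hν]
    refine WithDensityᵥEq.congr_ae ?_
    filter_upwards [h1] with x hx
    have : ‖g x‖ = 1 := by rw [← toReal_enorm, hx]; rfl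
    simp [this]

theorem variation_withDensityᵥ_le {m : Measure α} [IsFiniteMeasure m] {k : α → ℂ}
    (hkm : Measurable k) (hk : ∀ x, ‖k x‖ ≤ 1) : (m.withDensityᵥ k).variation ≤ m := by
  have hi : Integrable k m :=
    Integrable.of_bound hkm.aestronglyMeasurable 1 (Eventually.of_forall hk)
  rw [Measure.variation_withDensityᵥ hi]
  refine (withDensity_mono (Eventually.of_forall fun x => ?_)).trans_eq withDensity_one
  simpa [enorm_le_iff_norm_le] using (enorm_le_iff_norm_le (y := (1 : ℂ))).2 (by simpa using hk x)

theorem variation_withDensityᵥ_of_norm_eq_one {m : Measure α} [IsFiniteMeasure m] {k : α → ℂ}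
    (hkm : Measurable k) (hk : ∀ x, ‖k x‖ = 1) : (m.withDensityᵥ k).variation = m := by
  have hi : Integrable k m :=
    Integrable.of_bound hkm.aestronglyMeasurable 1 (Eventually.of_forall fun x => (hk x).le)
  rw [Measure.variation_withDensityᵥ hi]
  have : (fun x => ‖k x‖ₑ) = 1 := funext fun x => by
    rw [← ofReal_norm, hk x]; simp
  rw [this, withDensity_one]

/-- Integration against a complex measure with bounded density. -/
theorem integral_withDensityᵥ_of_bounded {m : Measure α} [IsFiniteMeasure m] {k : α → ℂ}
    (hkm : Measurable k) (hk : ∀ x, ‖k x‖ ≤ 1) {g : α → ℂ} (hg : Integrable g m) :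
    VectorMeasure.integral (m.withDensityᵥ k) g (ContinuousLinearMap.mul ℝ ℂ) =
      ∫ x, g x * k x ∂m := by
  have hi : Integrable k m :=
    Integrable.of_bound hkm.aestronglyMeasurable 1 (Eventually.of_forall hk)
  have hle := variation_withDensityᵥ_le (m := m) hkm hk
  have hmul : ∀ {f : α → ℂ}, Integrable f m → Integrable (fun x => f x * k x) m := fun hf =>
    hf.mul_bdd hkm.aestronglyMeasurable (c := 1) (Eventually.of_forall hk)
  refine Integrable.induction (P := fun g : α → ℂ =>
    VectorMeasure.integral (m.withDensityᵥ k) g (ContinuousLinearMap.mul ℝ ℂ) =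
      ∫ x, g x * k x ∂m) ?_ ?_ ?_ ?_ hg
  · intro c s hs hfin
    rw [VectorMeasure.integral_indicator hs, VectorMeasure.setIntegral_const,
      withDensityᵥ_apply hi hs, ContinuousLinearMap.mul_apply', ← integral_const_mul,
      ← integral_indicator hs]
    congr 1 with x
    by_cases hx : x ∈ s <;> simp [hx]
  · intro f g hfg hf hg ihf ihg
    have hf' := hf.mono_measure hle
    have hg' := hg.mono_measure hle
    rw [VectorMeasure.integral_add hf' hg', ihf, ihg, ← integral_add (hmul hf) (hmul hg)]
    simp [add_mul]
  · refine isClosed_eq ?_ ?_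
    · rw [continuous_iff_seqContinuous]
      intro u f hu
      refine VectorMeasure.tendsto_integral_of_L1 _
        ((L1.integrable_coeFn f).mono_measure hle).aestronglyMeasurable
        (Eventually.of_forall fun i => (L1.integrable_coeFn (u i)).mono_measure hle) ?_
      have h0 : Tendsto (fun i => ∫⁻ x, ‖u i x - f x‖ₑ ∂m) atTop (𝓝 0) := by
        have := (Lp.tendsto_Lp_iff_tendsto_eLpNorm' (fun i => u i) f).1 hu
        simpa [eLpNorm_one_eq_lintegral_enorm] using this
      exact tendsto_of_tendsto_of_tendsto_of_le_of_le tendsto_const_nhds h0 (fun _ => zero_le)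
        fun i => lintegral_mono' hle le_rfl
    · rw [continuous_iff_seqContinuous]
      intro u f hu
      refine tendsto_integral_of_L1 _ (hmul (L1.integrable_coeFn f)).1
        (Eventually.of_forall fun i => hmul (L1.integrable_coeFn (u i))) ?_
      have h0 : Tendsto (fun i => ∫⁻ x, ‖u i x - f x‖ₑ ∂m) atTop (𝓝 0) := by
        have := (Lp.tendsto_Lp_iff_tendsto_eLpNorm' (fun i => u i) f).1 hu
        simpa [eLpNorm_one_eq_lintegral_enorm] using this
      refine tendsto_of_tendsto_of_tendsto_of_le_of_le tendsto_const_nhds h0 (fun _ => zero_le)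
        fun i => lintegral_mono fun x => ?_
      rw [← sub_mul, enorm_mul]
      refine mul_le_of_le_one_right zero_le ?_
      simpa using (enorm_le_iff_norm_le (y := (1 : ℂ))).2 (by simpa using hk x)
  · intro f g hfg hf ih
    rw [← VectorMeasure.integral_congr_ae (hfg.filter_mono (ae_mono hle)), ih]
    refine integral_congr_ae ?_
    filter_upwards [hfg] with x hx
    rw [hx]

/-- Integration of a bounded function against a complex measure with integrable density. -/
theorem integral_withDensityᵥ {m : Measure α} {k : α → ℂ} (hkm : Measurable k)
    (hk : Integrable k m) {g : α → ℂ} (hg : Integrable g (m.withDensityᵥ k).variation) :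
    VectorMeasure.integral (m.withDensityᵥ k) g (ContinuousLinearMap.mul ℝ ℂ) =
      ∫ x, g x * k x ∂m := by
  have hvar := Measure.variation_withDensityᵥ hk
  -- Writing $k=|k|p$, with `p = 0` where `k = 0`, reduces to the bounded density `p` against the
  -- variation $|k|\,m$.
  set p : α → ℂ := fun x => (‖k x‖⁻¹ : ℝ) • k x
  have hpm : Measurable p := hkm.norm.inv.smul hkm
  have hp : ∀ x, ‖p x‖ ≤ 1 := fun x => by
    simp only [p, norm_smul, norm_inv, norm_norm]
    exact inv_mul_le_one
  have hpk : ∀ x, (‖k x‖ₑ.toReal : ℝ) • p x = k x := fun x => by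
    by_cases hx : k x = 0
    · simp [hx]
    · simp only [p, toReal_enorm, smul_smul]
      rw [mul_inv_cancel₀ (by simpa using hx), one_smul]
  have hfin : ∀ᵐ x ∂m, ‖k x‖ₑ < ∞ := Eventually.of_forall fun x => enorm_lt_top
  have heq : (m.withDensityᵥ k).variation.withDensityᵥ p = m.withDensityᵥ k := by
    ext E hE : 1
    rw [withDensityᵥ_apply (Integrable.of_bound hpm.aestronglyMeasurable 1
      (Eventually.of_forall hp)) hE, withDensityᵥ_apply hk hE, hvar, restrict_withDensity hE,
      integral_withDensity_eq_integral_toReal_smul₀ hkm.enorm.aemeasurable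
        (ae_restrict_of_ae hfin)]
    simp_rw [hpk]
  conv_lhs => rw [← heq]
  rw [integral_withDensityᵥ_of_bounded hpm hp hg, hvar,
    integral_withDensity_eq_integral_toReal_smul₀ hkm.enorm.aemeasurable hfin]
  refine integral_congr_ae (Eventually.of_forall fun x => ?_)
  simp only
  rw [← mul_smul_comm, hpk]

/-- A complex measure all of whose values on subsets of `s` are bounded by `c` has variation at
most `4 c` on `s`. -/
theorem variation_le_of_forall_subset (ν : ComplexMeasure α) {s : Set α} (hs : MeasurableSet s)
    {c : ℝ≥0∞} (h : ∀ t ⊆ s, MeasurableSet t → ‖ν t‖ₑ ≤ c) : ν.variation s ≤ 4 * c := by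
  by_contra! hc
  obtain ⟨t, hts, ht, hlt⟩ := ν.exists_subset_lt_enorm_apply hs hc
  exact absurd hlt (not_lt.2 (by gcongr; exact h t hts ht))

end MeasureTheory.ComplexMeasure

/-! ### Translations of `[0,1)` -/

namespace UnitIco

theorem volume_eq (A : Set UnitIco) : volume A = volume (Subtype.val '' A : Set ℝ) :=
  comap_subtype_coe_apply measurableSet_Ico _ _

instance isFiniteMeasure_volume : IsFiniteMeasure (volume : Measure UnitIco) :=
  ⟨by rw [volume_eq, image_univ, Subtype.range_coe]; simp⟩

theorem volume_Ico (a b : UnitIco) : volume (Set.Ico a b) = ENNReal.ofReal (b - a) := by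
  have : (Subtype.val '' Set.Ico a b : Set ℝ) = Set.Ico (a : ℝ) b := by
    ext x
    constructor
    · rintro ⟨y, hy, rfl⟩
      exact hy
    · intro hx
      exact ⟨⟨x, a.2.1.trans hx.1, hx.2.trans b.2.2⟩, hx, rfl⟩
  rw [volume_eq, this, Real.volume_Ico]

/-- The partially defined addition of `[0,1)`, with value `0` where the sum is not in `[0,1)`. -/
noncomputable def add (t s : UnitIco) : UnitIco :=
  ⟨if (t : ℝ) + s < 1 then t + s else 0, by
    split_ifs with h
    · exact ⟨add_nonneg t.2.1 s.2.1, h⟩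
    · simp⟩

theorem coe_add_of_lt {t s : UnitIco} (h : (t : ℝ) + s < 1) : (add t s : ℝ) = t + s := by
  simp [add, h]

theorem coe_tsub_of_le {t s : UnitIco} (h : s ≤ t) : (tsub t s : ℝ) = t - s :=
  max_eq_left (sub_nonneg.2 h)

theorem add_tsub_of_le {t s : UnitIco} (h : s ≤ t) : add (tsub t s) s = t := by
  have h1 : (tsub t s : ℝ) + s = t := by rw [coe_tsub_of_le h, sub_add_cancel]
  exact Subtype.ext ((coe_add_of_lt (by rw [h1]; exact t.2.2)).trans h1)

theorem measurableSet_add_lt : MeasurableSet {p : UnitIco × UnitIco | (p.1 : ℝ) + p.2 < 1} :=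
  measurableSet_lt (by fun_prop) measurable_const

theorem measurable_add : Measurable fun p : UnitIco × UnitIco => add p.1 p.2 :=
  Measurable.subtype_mk
    (Measurable.ite measurableSet_add_lt (by fun_prop) measurable_const)

theorem measurable_add_right (t : UnitIco) : Measurable (add t) :=
  measurable_add.comp measurable_prodMk_left

theorem measurable_tsub : Measurable fun p : UnitIco × UnitIco => tsub p.1 p.2 := by
  unfold tsub
  fun_prop

/-- The points of `[0,1)` below a real number. -/
def below (x : ℝ) : Set UnitIco := {s | (s : ℝ) < x}

@[simp]
theorem mem_below {x : ℝ} {s : UnitIco} : s ∈ below x ↔ (s : ℝ) < x := Iff.rfl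

theorem measurableSet_below (x : ℝ) : MeasurableSet (below x) :=
  measurableSet_lt measurable_subtype_coe measurable_const

theorem below_coe (x : UnitIco) : below x = Iio x := rfl

theorem below_mono {x y : ℝ} (h : x ≤ y) : below x ⊆ below y := fun _ hs => lt_of_lt_of_le hs h

theorem bddAbove_below {x : ℝ} (hx : x < 1) : BddAbove (below x) :=
  ⟨⟨max x 0, le_max_right _ _, max_lt hx one_pos⟩, fun s hs =>
    show (s : ℝ) ≤ max x 0 from (le_of_lt hs).trans (le_max_left _ _)⟩

theorem shift_eq (t : UnitIco) (E : Set UnitIco) :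
    shift t E = {s : UnitIco | (t : ℝ) + s < 1 ∧ add t s ∈ E} := by
  ext s
  constructor
  · rintro ⟨x, hx, h⟩
    have hlt : (t : ℝ) + s < 1 := by rw [add_comm, ← h]; exact x.2.2
    refine ⟨hlt, ?_⟩
    rwa [show add t s = x from Subtype.ext (by rw [coe_add_of_lt hlt, h, add_comm])]
  · rintro ⟨hlt, h⟩
    exact ⟨_, h, by rw [coe_add_of_lt hlt, add_comm]⟩

theorem measurableSet_shift (t : UnitIco) {E : Set UnitIco} (hE : MeasurableSet E) :
    MeasurableSet (shift t E) := by
  rw [shift_eq]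
  exact (measurableSet_add_lt.preimage measurable_prodMk_left).inter (measurable_add_right t hE)

theorem shift_subset (t : UnitIco) (E : Set UnitIco) : shift t E ⊆ below (1 - t) := by
  rw [shift_eq]
  exact fun s hs => by simpa using (lt_sub_iff_add_lt'.2 hs.1)

theorem bddAbove_shift {t : UnitIco} (ht : 0 < t) (E : Set UnitIco) : BddAbove (shift t E) :=
  (bddAbove_below (by have : (0 : ℝ) < t := ht; linarith)).mono (shift_subset t E)

theorem shift_below (t : UnitIco) {x : ℝ} (hx : x ≤ 1) : shift t (below x) = below (x - t) := by
  rw [shift_eq]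
  ext s
  simp only [mem_ofPred_eq, mem_below, lt_sub_iff_add_lt']
  constructor
  · rintro ⟨h, h'⟩
    rwa [coe_add_of_lt h] at h'
  · intro h
    have h1 := h.trans_le hx
    exact ⟨h1, by rwa [coe_add_of_lt h1]⟩

/-- The set on the left is the translate $A+t$. This recovers the values of $\mu$ on subsets of
$[0,1-t)$ from those of $t(\delta_t*\mu)$. -/
theorem shift_image_add (t : UnitIco) {A : Set UnitIco} (hA : A ⊆ below (1 - t)) :
    shift t {x | t ≤ x ∧ tsub x t ∈ A} = A := by
  rw [shift_eq]
  ext s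
  have key : ∀ h : (t : ℝ) + s < 1, t ≤ add t s ∧ tsub (add t s) t = s := fun h => by
    have h1 : t ≤ add t s := by
      change (t : ℝ) ≤ add t s
      rw [coe_add_of_lt h]
      linarith [s.2.1]
    exact ⟨h1, Subtype.ext (by rw [coe_tsub_of_le h1, coe_add_of_lt h]; ring)⟩
  constructor
  · rintro ⟨h, -, h'⟩
    rwa [(key h).2] at h'
  · intro h
    have h1 : (t : ℝ) + s < 1 := lt_sub_iff_add_lt'.1 (hA h)
    exact ⟨h1, (key h1).1, by rwa [(key h1).2]⟩

/-- Translation invariance on $\mathbb R$; the two restrictions remove the points where `tsub`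
truncates and those that $u\mapsto u+s$ moves out of $[0,1)$. -/
theorem measurePreserving_tsub (s : UnitIco) :
    MeasurePreserving (fun t => tsub t s) (volume.restrict (Ici s))
      (volume.restrict {u : UnitIco | (u : ℝ) + s < 1}) := by
  have hm : Measurable fun t => tsub t s := measurable_tsub.comp measurable_prodMk_right
  refine ⟨hm, ?_⟩
  ext E hE
  rw [Measure.map_apply hm hE, Measure.restrict_apply (hm hE), Measure.restrict_apply hE,
    volume_eq, volume_eq]
  have : (Subtype.val '' ((fun t => tsub t s) ⁻¹' E ∩ Ici s) : Set ℝ) =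
      (fun x : ℝ => x + (-s)) ⁻¹' (Subtype.val '' (E ∩ {u : UnitIco | (u : ℝ) + s < 1})) := by
    ext x
    constructor
    · rintro ⟨t, ⟨htE, hts⟩, rfl⟩
      refine ⟨tsub t s, ⟨htE, ?_⟩, ?_⟩
      · rw [mem_ofPred_eq, coe_tsub_of_le hts, sub_add_cancel]
        exact t.2.2
      · rw [coe_tsub_of_le hts, sub_eq_add_neg]
    · rintro ⟨u, ⟨huE, hus⟩, hux⟩
      have hx : x = u + s := by simp only at hux; linarith
      have hle : s ≤ (⟨x, by rw [hx]; exact add_nonneg u.2.1 s.2.1, by rw [hx]; exact hus⟩ :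
          UnitIco) := by
        change (s : ℝ) ≤ x
        rw [hx]
        linarith [u.2.1]
      refine ⟨⟨x, _⟩, ⟨?_, hle⟩, rfl⟩
      rw [mem_preimage]
      convert huE using 1
      exact Subtype.ext (by rw [coe_tsub_of_le hle]; simp [hx])
  rw [this, measure_preimage_add_right]

/-- The intervals $[0,x)$ with $x<1$ form a generating π-system; the case $x=1$ supplies the total
mass. -/
theorem ext_of_below {ν ρ : ComplexMeasure UnitIco}
    (h : ∀ x : ℝ, x ≤ 1 → ν (below x) = ρ (below x)) : ν = ρ := by
  refine VectorMeasure.ext_of_generateFrom (range Iio) ?_ ?_ isPiSystem_Iio ?_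
  · rintro _ ⟨x, rfl⟩
    exact h x x.2.2.le
  · rw [BorelSpace.measurable_eq (α := UnitIco), borel_eq_generateFrom_Iio]
  · have : (univ : Set UnitIco) = below 1 := by
      ext s
      simpa using s.2.2
    rw [this]
    exact h 1 le_rfl

end UnitIco

/-! ### Polar decomposition of a locally finite complex measure -/

namespace LocalComplexMeasure

open UnitIco

/-- `μ` has total variation `m` and polar density `h`. -/
structure IsPolar (μ : LocalComplexMeasure) (m : Measure UnitIco) (h : UnitIco → ℂ) : Prop where
  measurable : Measurable h
  norm_eq_one : ∀ x, ‖h x‖ = 1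
  measure_Iic_lt_top : ∀ a, m (Iic a) < ∞
  measureOf_eq : ∀ A, MeasurableSet A → BddAbove A → μ.measureOf A = ∫ x in A, h x ∂m

theorem restr_apply (μ : LocalComplexMeasure) {K A : Set UnitIco} (hA : MeasurableSet A)
    (hK : MeasurableSet K) (hKb : BddAbove K) : μ.restr K A = μ.measureOf (A ∩ K) := by
  exact if_pos ⟨hA, hK, hKb⟩

/-- The pieces of a countable decomposition of `[0,1)` into bounded sets. -/
noncomputable def pieceIndex (s : UnitIco) : ℕ := ⌊(1 - (s : ℝ))⁻¹⌋₊

theorem measurable_pieceIndex : Measurable pieceIndex := by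
  unfold pieceIndex
  exact Nat.measurable_floor.comp (by fun_prop)

theorem pieceIndex_mono : Monotone pieceIndex := fun s t hst => by
  have h1 : (0 : ℝ) < 1 - t := sub_pos.2 t.2.2
  have h2 : (s : ℝ) ≤ t := hst
  exact Nat.floor_mono (inv_anti₀ h1 (by linarith))

theorem bddAbove_piece (n : ℕ) : BddAbove (pieceIndex ⁻¹' {n}) := by
  have hn : (0 : ℝ) < n + 1 := by positivity
  refine (bddAbove_below (x := 1 - (n + 1 : ℝ)⁻¹) (by simp; positivity)).mono fun s hs => ?_
  have h0 : (0 : ℝ) < 1 - s := sub_pos.2 s.2.2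
  have h1 : (1 - (s : ℝ))⁻¹ < n + 1 := by
    have := Nat.lt_floor_add_one (1 - (s : ℝ))⁻¹
    rwa [show ⌊(1 - (s : ℝ))⁻¹⌋₊ = n from hs] at this
  have := (inv_lt_comm₀ h0 hn).1 h1
  rw [mem_below]
  linarith

/-- Polar decompositions on the disjoint bounded pieces are glued. Each variation `v n` is carried
by its own piece, and only finitely many pieces meet $[0,a]$, so the sum is finite there. -/
theorem exists_isPolar (μ : LocalComplexMeasure) :
    ∃ (m : Measure UnitIco) (h : UnitIco → ℂ), μ.IsPolar m h := by
  set K : ℕ → Set UnitIco := fun n => pieceIndex ⁻¹' {n} with hK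
  have hKm : ∀ n, MeasurableSet (K n) := fun n => measurable_pieceIndex (measurableSet_singleton n)
  choose k hkm hk1 hkν using fun n => (μ.restr (K n)).exists_polar
  set v : ℕ → Measure UnitIco := fun n => (μ.restr (K n)).variation with hv
  have hvK : ∀ n, ∀ A, MeasurableSet A → Disjoint A (K n) → v n A = 0 := fun n A hA hd => by
    refine (VectorMeasure.variation_apply_eq_zero hA).2 fun t ht htm => ?_
    rw [μ.restr_apply htm (hKm n) (bddAbove_piece n), (hd.mono_left ht).inter_eq, measureOf_empty]
  set h : UnitIco → ℂ := fun x => k (pieceIndex x) x with hh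
  have hhm : Measurable h :=
    (measurable_from_prod_countable_right (f := fun p : ℕ × UnitIco => k p.1 p.2) hkm).comp
      (measurable_pieceIndex.prodMk measurable_id)
  have hh1 : ∀ x, ‖h x‖ = 1 := fun x => hk1 _ x
  have hfin : ∀ a, Measure.sum v (Iic a) < ∞ := fun a => by
    rw [Measure.sum_apply _ measurableSet_Iic, tsum_eq_sum (s := Finset.range (pieceIndex a + 1))]
    · exact ENNReal.sum_lt_top.2 fun n _ => measure_lt_top _ _
    · intro n hn
      refine hvK n _ measurableSet_Iic (disjoint_left.2 fun x hx hxn => hn ?_)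
      have h1 : pieceIndex x = n := hxn
      have h2 := pieceIndex_mono hx
      rw [Finset.mem_range]
      omega
  refine ⟨Measure.sum v, h, hhm, hh1, hfin, fun A hA hAb => ?_⟩
  obtain ⟨a, ha⟩ := hAb
  have hAfin : IsFiniteMeasure ((Measure.sum v).restrict A) :=
    ⟨by rw [Measure.restrict_apply_univ]; exact (measure_mono ha).trans_lt (hfin a)⟩
  have hint : Integrable h ((Measure.sum v).restrict A) :=
    Integrable.of_bound hhm.aestronglyMeasurable 1 (Eventually.of_forall fun x => (hh1 x).le)
  have hae : ∀ n, ∀ᵐ x ∂(v n).restrict A, h x = k n x := fun n => by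
    refine ae_restrict_of_ae ?_
    have : v n (K n)ᶜ = 0 := hvK n _ (hKm n).compl disjoint_compl_left
    filter_upwards [mem_ae_iff.2 this] with x hx
    rw [hh]
    simp only
    rw [show pieceIndex x = n from hx]
  rw [Measure.restrict_sum _ hA] at hint ⊢
  have hs1 := hasSum_integral_measure hint
  have heq : ∀ n, ∫ x, h x ∂(v n).restrict A = μ.measureOf (A ∩ K n) := fun n => by
    rw [integral_congr_ae (hae n), ← μ.restr_apply hA (hKm n) (bddAbove_piece n)]
    conv_rhs => rw [← hkν n]
    rw [withDensityᵥ_apply _ hA]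
    exact Integrable.of_bound (hkm n).aestronglyMeasurable 1
      (Eventually.of_forall fun x => (hk1 n x).le)
  simp_rw [heq] at hs1
  have hU : ⋃ n, A ∩ K n = A := by
    rw [← inter_iUnion, inter_eq_left]
    exact fun x _ => mem_iUnion.2 ⟨pieceIndex x, rfl⟩
  have hs2 := μ.iUnion' (fun n => A ∩ K n) (fun n => hA.inter (hKm n))
    (fun i j hij => by
      refine Disjoint.mono inter_subset_right inter_subset_right ?_
      exact Disjoint.preimage _ (by simpa using hij)) (by rw [hU]; exact ⟨a, ha⟩)
  rw [hU] at hs2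
  exact hs2.unique hs1

namespace IsPolar

variable {μ : LocalComplexMeasure} {m : Measure UnitIco} {h : UnitIco → ℂ} (hp : μ.IsPolar m h)
include hp

theorem measure_lt_top {A : Set UnitIco} (hA : BddAbove A) : m A < ∞ := by
  obtain ⟨a, ha⟩ := hA
  exact (measure_mono ha).trans_lt (hp.measure_Iic_lt_top a)

theorem sigmaFinite : SigmaFinite m := by
  have : IsLocallyFiniteMeasure m := ⟨fun x => by
    obtain ⟨b, hb⟩ := exists_gt x
    exact ⟨Iic b, Iic_mem_nhds hb, hp.measure_Iic_lt_top b⟩⟩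
  infer_instance

theorem isFiniteMeasure_restrict {K : Set UnitIco} (hK : BddAbove K) :
    IsFiniteMeasure (m.restrict K) :=
  ⟨by rw [Measure.restrict_apply_univ]; exact hp.measure_lt_top hK⟩

theorem integrableOn {K : Set UnitIco} (hK : BddAbove K) : IntegrableOn h K m :=
  have := hp.isFiniteMeasure_restrict hK
  Integrable.of_bound hp.measurable.aestronglyMeasurable 1
    (Eventually.of_forall fun x => (hp.norm_eq_one x).le)

theorem restr_eq {K : Set UnitIco} (hK : MeasurableSet K) (hKb : BddAbove K) :
    μ.restr K = (m.restrict K).withDensityᵥ h := by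
  ext A hA : 1
  rw [μ.restr_apply hA hK hKb, withDensityᵥ_apply (hp.integrableOn hKb) hA,
    Measure.restrict_restrict hA]
  exact hp.measureOf_eq _ (hA.inter hK) (hKb.mono inter_subset_right)

theorem variation_restr {K : Set UnitIco} (hK : MeasurableSet K) (hKb : BddAbove K) :
    (μ.restr K).variation = m.restrict K := by
  have := hp.isFiniteMeasure_restrict hKb
  rw [hp.restr_eq hK hKb,
    ComplexMeasure.variation_withDensityᵥ_of_norm_eq_one hp.measurable hp.norm_eq_one]

theorem totalVar_eq {K : Set UnitIco} (hK : MeasurableSet K) (hKb : BddAbove K) :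
    μ.totalVar K = m K := by
  rw [totalVar, hp.variation_restr hK hKb, Measure.restrict_apply_univ]

theorem tailFun_eq {t : ℝ} (ht : 0 < t) : μ.tailFun t = ENNReal.ofReal t * m (below (1 - t)) := by
  rw [tailFun]
  congr 1
  exact hp.totalVar_eq (measurableSet_below _) (bddAbove_below (by linarith))

theorem enorm_measureOf_le {A : Set UnitIco} (hA : MeasurableSet A) (hAb : BddAbove A) :
    ‖μ.measureOf A‖ₑ ≤ m A := by
  rw [hp.measureOf_eq A hA hAb]
  refine (enorm_integral_le_lintegral_enorm _).trans_eq ?_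
  have : ∀ x, ‖h x‖ₑ = 1 := fun x => by rw [← ofReal_norm, hp.norm_eq_one x, ENNReal.ofReal_one]
  simp [this]

/-- If `t |μ|([0,1-t))` is bounded near `0`, it is bounded on `(0,1)`. -/
theorem exists_tail_bound (hμ : μ.TailBounded) :
    ∃ C : ℝ, ∀ t : ℝ, 0 < t → t < 1 →
      ENNReal.ofReal t * m (below (1 - t)) ≤ ENNReal.ofReal C := by
  obtain ⟨C, hC⟩ := hμ
  obtain ⟨δ, hδ, hCδ⟩ := (mem_nhdsGT_iff_exists_Ioo_subset).1 hC
  have hδ0 : (0 : ℝ) < δ := hδ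
  have hfin : m (below (1 - δ)) < ∞ := hp.measure_lt_top (bddAbove_below (by linarith))
  refine ⟨max C (m (below (1 - δ))).toReal, fun t ht ht1 => ?_⟩
  rcases lt_or_ge t δ with h | h
  · rw [← hp.tailFun_eq ht]
    exact (hCδ ⟨ht, h⟩).trans (ENNReal.ofReal_le_ofReal (le_max_left _ _))
  · calc ENNReal.ofReal t * m (below (1 - t)) ≤ 1 * m (below (1 - δ)) := by
          gcongr
          · exact ENNReal.ofReal_le_one.2 ht1.le
          · exact below_mono (by linarith)
      _ = ENNReal.ofReal (m (below (1 - δ))).toReal := by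
          rw [one_mul, ENNReal.ofReal_toReal hfin.ne]
      _ ≤ _ := ENNReal.ofReal_le_ofReal (le_max_right _ _)

end IsPolar

end LocalComplexMeasure

/-! ### The embedding of `L¹[0,1)` into `M[0,1)` -/

/-- The isometric embedding of `L¹[0,1)` into `M[0,1)` as absolutely continuous measures. -/
noncomputable def VolterraL1.toMeasure : VolterraL1 →ₗᵢ[ℂ] VolterraM where
  toFun f := volume.withDensityᵥ f
  map_add' f g := by
    rw [WithDensityᵥEq.congr_ae (Lp.coeFn_add f g),
      withDensityᵥ_add (L1.integrable_coeFn f) (L1.integrable_coeFn g)]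
  map_smul' c f := by
    rw [WithDensityᵥEq.congr_ae (Lp.coeFn_smul c f), withDensityᵥ_smul, RingHom.id_apply]
  norm_map' f := by
    have h : ‖(volume.withDensityᵥ f : VolterraM)‖ₑ = ‖f‖ₑ := by
      rw [ComplexMeasure.enorm_eq, Measure.variation_withDensityᵥ (L1.integrable_coeFn f),
        withDensity_apply _ MeasurableSet.univ, Measure.restrict_univ, Lp.enorm_def,
        eLpNorm_one_eq_lintegral_enorm]
    have := congrArg ENNReal.toReal h
    simpa using this

namespace VolterraL1

theorem toMeasure_apply (f : VolterraL1) {E : Set UnitIco} (hE : MeasurableSet E) :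
    toMeasure f E = ∫ t in E, f t :=
  withDensityᵥ_apply (L1.integrable_coeFn f) hE

theorem toMeasure_apply_of_volume_eq_zero (f : VolterraL1) {E : Set UnitIco}
    (hE : MeasurableSet E) (h0 : volume E = 0) : toMeasure f E = 0 := by
  rw [toMeasure_apply f hE, setIntegral_measure_zero _ h0]

end VolterraL1

/-! ### Construction of the operators -/

namespace LocalComplexMeasure

open UnitIco

/-- The function `t ↦ t μ({s : s + t ∈ E})`. -/
noncomputable def weightedShift (μ : LocalComplexMeasure) (E : Set UnitIco) (t : UnitIco) : ℂ :=
  ((t : ℝ) : ℂ) * μ.measureOf (shift t E)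

namespace IsPolar

variable {μ : LocalComplexMeasure} {m : Measure UnitIco} {h : UnitIco → ℂ} (hp : μ.IsPolar m h)
include hp

/-- The weighted density `t h(s)` of `t * (δ_t * μ)` at `(t, s)`, restricted to `{t + s < 1}`. -/
theorem measurable_kernel : Measurable
    ({p : UnitIco × UnitIco | (p.1 : ℝ) + p.2 < 1}.indicator
      fun p => ((p.1 : ℝ) : ℂ) * h p.2) := by
  have := hp.measurable
  refine Measurable.indicator ?_ measurableSet_add_lt
  fun_prop

/-- As a partial integral over the product space the function is measurable in `t` and open to
Fubini. At `t = 0` the set `shift t E` may be unbounded and `measureOf` a default value, but the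
factor `t` vanishes. -/
theorem weightedShift_eq {E : Set UnitIco} (hE : MeasurableSet E) (t : UnitIco) :
    μ.weightedShift E t = ∫ s, ((fun p : UnitIco × UnitIco => add p.1 p.2) ⁻¹' E).indicator
      ({p : UnitIco × UnitIco | (p.1 : ℝ) + p.2 < 1}.indicator
        fun p => ((p.1 : ℝ) : ℂ) * h p.2) (t, s) ∂m := by
  rcases eq_or_lt_of_le (bot_le : (0 : UnitIco) ≤ t) with h0 | h0
  · have : ∀ p : UnitIco × UnitIco, p.1 = t → ((p.1 : ℝ) : ℂ) * h p.2 = 0 := by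
      rintro p hpt
      rw [hpt, ← h0]
      simp
    rw [weightedShift, ← h0]
    simp [indicator]
  · rw [weightedShift, hp.measureOf_eq _ (measurableSet_shift t hE) (bddAbove_shift h0 E),
      ← integral_const_mul, ← integral_indicator (measurableSet_shift t hE), shift_eq]
    congr 1 with s
    by_cases h1 : (t : ℝ) + s < 1 <;> by_cases h2 : add t s ∈ E <;> simp [h1, h2, indicator]

theorem stronglyMeasurable_weightedShift {E : Set UnitIco} (hE : MeasurableSet E) :
    StronglyMeasurable (μ.weightedShift E) := by
  have := hp.sigmaFinite
  rw [show μ.weightedShift E = _ from funext (hp.weightedShift_eq hE)]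
  exact StronglyMeasurable.integral_prod_right
    (f := fun t s => ((fun p : UnitIco × UnitIco => add p.1 p.2) ⁻¹' E).indicator
      ({p : UnitIco × UnitIco | (p.1 : ℝ) + p.2 < 1}.indicator
        fun p => ((p.1 : ℝ) : ℂ) * h p.2) (t, s))
    (hp.measurable_kernel.indicator (measurable_add hE)).stronglyMeasurable

theorem enorm_weightedShift_le {E : Set UnitIco} (hE : MeasurableSet E) (t : UnitIco) :
    ‖μ.weightedShift E t‖ₑ ≤ ENNReal.ofReal t * m (shift t E) := by
  rcases eq_or_lt_of_le (bot_le : (0 : UnitIco) ≤ t) with h0 | h0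
  · rw [weightedShift, ← h0]
    simp
  · rw [weightedShift, enorm_mul]
    gcongr
    · rw [← ofReal_norm, Complex.norm_real, Real.norm_of_nonneg t.2.1]
    · exact hp.enorm_measureOf_le (measurableSet_shift t hE) (bddAbove_shift h0 E)

section Bounded

variable {C : ℝ} (hC : ∀ t : ℝ, 0 < t → t < 1 →
  ENNReal.ofReal t * m (below (1 - t)) ≤ ENNReal.ofReal C)
include hC

omit hp in
theorem tail_le (t : UnitIco) : ENNReal.ofReal t * m (below (1 - t)) ≤ ENNReal.ofReal C := by
  rcases eq_or_lt_of_le (bot_le : (0 : UnitIco) ≤ t) with h0 | h0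
  · rw [← h0]
    simp
  · exact hC t h0 t.2.2

theorem enorm_weightedShift_le_const {E : Set UnitIco} (hE : MeasurableSet E) (t : UnitIco) :
    ‖μ.weightedShift E t‖ₑ ≤ ENNReal.ofReal C :=
  (hp.enorm_weightedShift_le hE t).trans
    ((mul_le_mul_right (measure_mono (shift_subset t E)) _).trans (tail_le hC t))

theorem integrable_weightedShift {E : Set UnitIco} (hE : MeasurableSet E) (l : Measure UnitIco)
    [IsFiniteMeasure l] : Integrable (μ.weightedShift E) l := by
  refine Integrable.of_bound (hp.stronglyMeasurable_weightedShift hE).aestronglyMeasurable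
    (ENNReal.ofReal C).toReal (Eventually.of_forall fun t => ?_)
  rw [← toReal_enorm]
  exact ENNReal.toReal_mono ENNReal.ofReal_ne_top (hp.enorm_weightedShift_le_const hC hE t)

/-- By Tonelli: the inner integral over `s` is $|k(t)|\,t\,m([0,1-t))$. -/
theorem lintegral_kernel_le {l : Measure UnitIco} [SFinite l] {k : UnitIco → ℂ}
    (hkm : Measurable k) :
    ∫⁻ p, ‖k p.1 * ({p : UnitIco × UnitIco | (p.1 : ℝ) + p.2 < 1}.indicator
      (fun p => ((p.1 : ℝ) : ℂ) * h p.2) p)‖ₑ ∂(l.prod m) ≤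
      ENNReal.ofReal C * ∫⁻ t, ‖k t‖ₑ ∂l := by
  have := hp.sigmaFinite
  have hk := hp.measurable_kernel
  rw [lintegral_prod _ (by fun_prop), ← lintegral_const_mul _ hkm.enorm]
  refine lintegral_mono fun t => ?_
  have h1 : ∀ s, ‖k t * ({p : UnitIco × UnitIco | (p.1 : ℝ) + p.2 < 1}.indicator
      (fun p => ((p.1 : ℝ) : ℂ) * h p.2) (t, s))‖ₑ =
      (below (1 - t)).indicator (fun _ => ‖k t‖ₑ * ENNReal.ofReal t) s := fun s => by
    have hh : ‖h s‖ₑ = 1 := by rw [← ofReal_norm, hp.norm_eq_one s, ENNReal.ofReal_one]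
    have ht : ‖((t : ℝ) : ℂ)‖ₑ = ENNReal.ofReal t := by
      rw [← ofReal_norm, Complex.norm_real, Real.norm_of_nonneg t.2.1]
    by_cases hs : (t : ℝ) + s < 1
    · have : s ∈ below (1 - t) := lt_sub_iff_add_lt'.2 hs
      simp [hs, this, hh, ht, -mem_below]
    · have : s ∉ below (1 - t) := fun hc => hs (lt_sub_iff_add_lt'.1 hc)
      simp [hs, this, -mem_below]
  simp_rw [h1]
  rw [lintegral_indicator_const (measurableSet_below _), mul_assoc, mul_comm]
  gcongr
  exact tail_le hC t

/-- The convolution `X(k l) * μ`, for a measure with density `k` with respect to `l`. -/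
theorem exists_convolution {l : Measure UnitIco} [SFinite l] {k : UnitIco → ℂ}
    (hkm : Measurable k) (hk : Integrable k l) :
    ∃ ρ : VolterraM, (∀ E, MeasurableSet E → ρ E = ∫ t, μ.weightedShift E t * k t ∂l) ∧
      ‖ρ‖ₑ ≤ ENNReal.ofReal C * ∫⁻ t, ‖k t‖ₑ ∂l := by
  have := hp.sigmaFinite
  set F : UnitIco × UnitIco → ℂ := fun p => k p.1 *
    ({p : UnitIco × UnitIco | (p.1 : ℝ) + p.2 < 1}.indicator
      (fun p => ((p.1 : ℝ) : ℂ) * h p.2) p) with hF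
  have hker := hp.measurable_kernel
  have hFm : Measurable F := by fun_prop
  have hle := hp.lintegral_kernel_le hC (l := l) hkm
  have hFi : Integrable F (l.prod m) :=
    ⟨hFm.aestronglyMeasurable, hle.trans_lt (ENNReal.mul_lt_top ENNReal.ofReal_lt_top hk.2)⟩
  -- The default value `0` of `add` adds no spurious mass, since `F` vanishes where the sum leaves
  -- $[0,1)$.
  refine ⟨((l.prod m).withDensityᵥ F).map fun p => add p.1 p.2, fun E hE => ?_, ?_⟩
  · rw [VectorMeasure.map_apply _ measurable_add hE, withDensityᵥ_apply hFi (measurable_add hE),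
      ← integral_indicator (measurable_add hE),
      integral_prod _ (hFi.indicator (measurable_add hE))]
    congr 1 with t
    rw [hp.weightedShift_eq hE, ← integral_mul_const]
    congr 1 with s
    rw [hF]
    by_cases h2 : (t, s) ∈ (fun p : UnitIco × UnitIco => add p.1 p.2) ⁻¹' E
    · rw [indicator_of_mem h2, indicator_of_mem h2, mul_comm]
    · rw [indicator_of_notMem h2, indicator_of_notMem h2, zero_mul]
  · rw [ComplexMeasure.enorm_eq]
    refine (VectorMeasure.variation_map_le univ).trans ?_
    rw [Measure.map_apply measurable_add MeasurableSet.univ, preimage_univ,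
      Measure.variation_withDensityᵥ hFi, withDensity_apply _ MeasurableSet.univ,
      Measure.restrict_univ]
    exact hle

theorem exists_measureDerivation :
    ∃ D : VolterraM →L[ℂ] VolterraM, IsVolterraMeasureDerivation μ D := by
  have hex : ∀ ν : VolterraM, ∃ ρ : VolterraM, (∀ E, MeasurableSet E →
      ρ E = ν.integral (μ.weightedShift E) (ContinuousLinearMap.mul ℝ ℂ)) ∧
      ‖ρ‖ ≤ (ENNReal.ofReal C).toReal * ‖ν‖ := fun ν => by
    obtain ⟨k, hkm, hk1, hkν⟩ := ν.exists_polar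
    have hki : Integrable k ν.variation :=
      Integrable.of_bound hkm.aestronglyMeasurable 1 (Eventually.of_forall fun x => (hk1 x).le)
    obtain ⟨ρ, hρ, hle⟩ := hp.exists_convolution hC hkm hki
    refine ⟨ρ, fun E hE => ?_, ?_⟩
    · rw [hρ E hE, ← ComplexMeasure.integral_withDensityᵥ_of_bounded hkm (fun x => (hk1 x).le)
        (hp.integrable_weightedShift hC hE _), hkν]
    · have h1 : ∀ x, ‖k x‖ₑ = 1 := fun x => by rw [← ofReal_norm, hk1 x, ENNReal.ofReal_one]
      simp only [h1, lintegral_const, one_mul] at hle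
      rw [← ComplexMeasure.enorm_eq] at hle
      have := ENNReal.toReal_mono (ENNReal.mul_ne_top ENNReal.ofReal_ne_top enorm_ne_top) hle
      rwa [ENNReal.toReal_mul, toReal_enorm, toReal_enorm] at this
  choose T hT hTn using hex
  refine ⟨LinearMap.mkContinuous
    { toFun := T
      map_add' := fun ν ρ => VectorMeasure.ext fun E hE => ?_
      map_smul' := fun c ν => VectorMeasure.ext fun E hE => ?_ } ((ENNReal.ofReal C).toReal) hTn, fun ν E hE =>
      ⟨hp.integrable_weightedShift hC hE _, hT ν E hE⟩⟩
  · rw [_root_.add_apply, hT _ E hE, hT _ E hE, hT _ E hE]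
    exact VectorMeasure.integral_add_vectorMeasure (hp.integrable_weightedShift hC hE _)
      (hp.integrable_weightedShift hC hE _)
  · change T (c • ν) E = c * T ν E
    rw [hT _ E hE, hT _ E hE]
    obtain ⟨k, hkm, hk1, hkν⟩ := ν.exists_polar
    have hki : Integrable k ν.variation :=
      Integrable.of_bound hkm.aestronglyMeasurable 1 (Eventually.of_forall fun x => (hk1 x).le)
    -- The density `c • k` need not be bounded by 1, so the version for integrable densities is
    -- applied.
    have hc : c • ν = ν.variation.withDensityᵥ (c • k) := by
      rw [withDensityᵥ_smul, hkν]
    have h1 := ComplexMeasure.integral_withDensityᵥ (hkm.const_smul c) (hki.smul c)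
      (hp.integrable_weightedShift hC hE _)
    rw [hc, h1]
    conv_rhs => rw [← hkν]
    rw [ComplexMeasure.integral_withDensityᵥ_of_bounded hkm (fun x => (hk1 x).le)
        (hp.integrable_weightedShift hC hE _), ← integral_const_mul]
    congr 1 with t
    simp only [Pi.smul_apply, smul_eq_mul]
    ring

theorem measureDerivation_toMeasure {Dbar : VolterraM →L[ℂ] VolterraM}
    (hD : IsVolterraMeasureDerivation μ Dbar) (f : VolterraL1) {E : Set UnitIco}
    (hE : MeasurableSet E) :
    Dbar (VolterraL1.toMeasure f) E = ∫ t, μ.weightedShift E t * f t := by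
  rw [(hD _ E hE).2]
  exact ComplexMeasure.integral_withDensityᵥ (Lp.stronglyMeasurable f).measurable
    (L1.integrable_coeFn f) (hp.integrable_weightedShift hC hE _)

/-- The substitution $t=u+s$ for fixed $s$ matches the integrand `F` of $D_\mu$ with the kernel `K`
of $\overline D_\mu$. Integrability passes from `K` to `F`, and swapping the integrals, substituting
and swapping back gives the intertwining identity, from which `D` inherits linearity and
boundedness. -/
theorem exists_derivation {Dbar : VolterraM →L[ℂ] VolterraM}
    (hD : IsVolterraMeasureDerivation μ Dbar) :
    ∃ D : VolterraL1 →L[ℂ] VolterraL1, IsVolterraDerivation μ D ∧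
      ∀ f, VolterraL1.toMeasure (D f) = Dbar (VolterraL1.toMeasure f) := by
  have hsf := hp.sigmaFinite
  have hhm := hp.measurable
  have hex : ∀ f : VolterraL1, ∃ g : VolterraL1, (∀ᵐ t : UnitIco,
      (μ.restr (Set.Iic t)).Integrable (fun s : UnitIco => ((tsub t s : ℝ) : ℂ) * f (tsub t s)) ∧
      g t = (μ.restr (Set.Iic t)).integral (fun s : UnitIco => ((tsub t s : ℝ) : ℂ) * f (tsub t s))
        (ContinuousLinearMap.mul ℝ ℂ)) ∧
      VolterraL1.toMeasure g = Dbar (VolterraL1.toMeasure f) := fun f => by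
    have hfm : Measurable f := (Lp.stronglyMeasurable f).measurable
    have htm := measurable_tsub
    set F : UnitIco × UnitIco → ℂ := {p : UnitIco × UnitIco | p.2 ≤ p.1}.indicator
      fun p => ((tsub p.1 p.2 : ℝ) : ℂ) * f (tsub p.1 p.2) * h p.2 with hF
    set K : UnitIco × UnitIco → ℂ := fun p => f p.1 *
      ({p : UnitIco × UnitIco | (p.1 : ℝ) + p.2 < 1}.indicator
        (fun p => ((p.1 : ℝ) : ℂ) * h p.2) p) with hK
    have hker := hp.measurable_kernel
    have hKm : Measurable K := by fun_prop
    have hFm : Measurable F :=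
      Measurable.indicator (by fun_prop) (measurableSet_le measurable_snd measurable_fst)
    have hKi : Integrable K (volume.prod m) :=
      ⟨hKm.aestronglyMeasurable, (hp.lintegral_kernel_le hC (l := volume) hfm).trans_lt
        (ENNReal.mul_lt_top ENNReal.ofReal_lt_top (L1.integrable_coeFn f).2)⟩
    have hFs : ∀ t s, F (t, s) = (Ici s).indicator
        (fun t => ((tsub t s : ℝ) : ℂ) * f (tsub t s) * h s) t := fun t s => rfl
    have hKs : ∀ u s, K (u, s) = {u : UnitIco | (u : ℝ) + s < 1}.indicator
        (fun u => ((u : ℝ) : ℂ) * f u * h s) u := fun u s => by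
      by_cases hu : (u : ℝ) + s < 1
      · simp only [hK, indicator, mem_ofPred_eq, hu, if_true]
        ring
      · simp [hK, indicator, hu]
    have hms : ∀ s : UnitIco, MeasurableSet {u : UnitIco | (u : ℝ) + s < 1} := fun s =>
      measurableSet_add_lt.preimage measurable_prodMk_right
    have hFi : Integrable F (volume.prod m) := by
      refine ⟨hFm.aestronglyMeasurable, lt_of_eq_of_lt ?_ hKi.2⟩
      rw [lintegral_prod_symm _ (by fun_prop), lintegral_prod_symm _ (by fun_prop)]
      congr 1 with s
      simp only [hFs, hKs, enorm_indicator_eq_indicator_enorm]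
      rw [lintegral_indicator measurableSet_Ici, lintegral_indicator (hms s),
        ← (measurePreserving_tsub s).lintegral_comp (by fun_prop)]
    have hG := hFi.integral_prod_left
    refine ⟨hG.toL1 _, ?_, ?_⟩
    · filter_upwards [hFi.prod_right_ae, hG.coeFn_toL1] with t ht htG
      have hFt : (fun s => F (t, s)) = (Iic t).indicator
          (fun s => ((tsub t s : ℝ) : ℂ) * f (tsub t s) * h s) := rfl
      have htm' : Measurable (tsub t) := htm.comp measurable_prodMk_left
      rw [hFt, integrable_indicator_iff measurableSet_Iic] at ht
      have hfin := hp.isFiniteMeasure_restrict (bddAbove_Iic (a := t))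
      have hint : Integrable (fun s => ((tsub t s : ℝ) : ℂ) * f (tsub t s)) (m.restrict (Iic t)) :=
        Integrable.mono ht (by fun_prop) (Eventually.of_forall fun s => by
          rw [norm_mul _ (h s), hp.norm_eq_one, mul_one])
      refine ⟨?_, ?_⟩
      · change Integrable _ (μ.restr (Iic t)).variation
        rwa [hp.variation_restr measurableSet_Iic bddAbove_Iic]
      · rw [htG, hFt, integral_indicator measurableSet_Iic,
          hp.restr_eq measurableSet_Iic bddAbove_Iic,
          ComplexMeasure.integral_withDensityᵥ_of_bounded hhm (fun x => (hp.norm_eq_one x).le) hint]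
    · ext E hE : 1
      rw [VolterraL1.toMeasure_apply _ hE, hp.measureDerivation_toMeasure hC hD f hE,
        ← integral_indicator hE]
      calc ∫ t, E.indicator (hG.toL1 _) t
          = ∫ t, ∫ s, (Prod.fst ⁻¹' E).indicator F (t, s) ∂m := by
            refine integral_congr_ae ?_
            filter_upwards [hG.coeFn_toL1] with t ht
            by_cases htE : t ∈ E
            · rw [indicator_of_mem htE, ht]
              simp [indicator, htE]
            · simp [htE, indicator]
        _ = ∫ s, (∫ t, (Prod.fst ⁻¹' E).indicator F (t, s)) ∂m :=
            integral_integral_swap (f := fun t s => (Prod.fst ⁻¹' E).indicator F (t, s)) (hFi.indicator (measurable_fst hE))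
        _ = ∫ s, (∫ u,
            ((fun p : UnitIco × UnitIco => add p.1 p.2) ⁻¹' E).indicator K (u, s)) ∂m := by
            congr 1 with s
            have hA : Measurable fun u => ((fun u => add u s) ⁻¹' E).indicator
                (fun u => ((u : ℝ) : ℂ) * f u * h s) u :=
              Measurable.indicator (by fun_prop) (measurable_add.comp measurable_prodMk_right hE)
            have h1 : ∀ t, (Prod.fst ⁻¹' E).indicator F (t, s) = (Ici s).indicator (fun t =>
                ((fun u => add u s) ⁻¹' E).indicator (fun u => ((u : ℝ) : ℂ) * f u * h s)
                  (tsub t s)) t := fun t => by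
              by_cases hts : s ≤ t
              · by_cases htE : t ∈ E <;> simp [indicator, hF, hts, add_tsub_of_le hts, htE]
              · simp [indicator, hF, hts]
            have h2 : ∀ u, ((fun p : UnitIco × UnitIco => add p.1 p.2) ⁻¹' E).indicator K (u, s) =
                {u : UnitIco | (u : ℝ) + s < 1}.indicator (fun u =>
                ((fun u => add u s) ⁻¹' E).indicator (fun u => ((u : ℝ) : ℂ) * f u * h s) u) u :=
              fun u => by
              by_cases hu : (u : ℝ) + s < 1 <;> by_cases huE : add u s ∈ E <;>
                simp [indicator, hKs, hu, huE]
            simp_rw [h1, h2]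
            rw [integral_indicator measurableSet_Ici, integral_indicator (hms s),
              ← (measurePreserving_tsub s).map_eq, integral_map]
            · exact (measurePreserving_tsub s).measurable.aemeasurable
            · exact hA.aestronglyMeasurable
        _ = ∫ u, ∫ s, ((fun p : UnitIco × UnitIco => add p.1 p.2) ⁻¹' E).indicator K (u, s) ∂m :=
            (integral_integral_swap (f := fun u s =>
              ((fun p : UnitIco × UnitIco => add p.1 p.2) ⁻¹' E).indicator K (u, s))
              (hKi.indicator (UnitIco.measurable_add hE))).symm
        _ = _ := by
            congr 1 with u
            rw [hp.weightedShift_eq hE, ← integral_mul_const]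
            congr 1 with s
            by_cases h2 : (u, s) ∈ (fun p : UnitIco × UnitIco => add p.1 p.2) ⁻¹' E
            · rw [indicator_of_mem h2, indicator_of_mem h2, mul_comm]
            · rw [indicator_of_notMem h2, indicator_of_notMem h2, zero_mul]
  choose T hT hTι using hex
  have hinj := VolterraL1.toMeasure.injective
  refine ⟨LinearMap.mkContinuous
    { toFun := T
      map_add' := fun f g => hinj (by rw [map_add, hTι, hTι, hTι, map_add, map_add])
      map_smul' := fun c f => hinj (by
        rw [RingHom.id_apply, map_smul, hTι, hTι, map_smul, map_smul]) } ‖Dbar‖ fun f => ?_,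
    hT, hTι⟩
  change ‖T f‖ ≤ _
  rw [← VolterraL1.toMeasure.norm_map, hTι, ← VolterraL1.toMeasure.norm_map f]
  exact Dbar.le_opNorm _

end Bounded

end IsPolar

end LocalComplexMeasure

/-! ### Weakly compact operators -/

section WeaklyCompact

variable {E F G : Type*} [NormedAddCommGroup E] [NormedSpace ℂ E] [NormedAddCommGroup F]
  [NormedSpace ℂ F] [NormedAddCommGroup G] [NormedSpace ℂ G]

/-- The norm-compact closure is weakly compact, hence weakly closed, so it contains the weak
closure. -/
theorem IsCompactOperator.isWeaklyCompactOperator {T : E →L[ℂ] F} (hT : IsCompactOperator T) :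
    IsWeaklyCompactOperator T := by
  have hK : IsCompact (closure (T '' Metric.closedBall (0 : E) 1)) :=
    hT.isCompact_closure_image_closedBall (f := T.toLinearMap) 1
  have hK' : IsCompact (toWeakSpace ℂ F '' closure (T '' Metric.closedBall (0 : E) 1)) :=
    hK.image (toWeakSpaceCLM ℂ F).continuous
  exact hK'.of_isClosed_subset isClosed_closure
    (closure_minimal (image_mono subset_closure) hK'.isClosed)

theorem IsWeaklyCompactOperator.clm_comp {T : E →L[ℂ] F} (hT : IsWeaklyCompactOperator T)
    (S : F →L[ℂ] G) : IsWeaklyCompactOperator (S.comp T) := by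
  have hK := hT.image (WeakSpace.map S).continuous
  refine hK.of_isClosed_subset isClosed_closure (closure_minimal ?_ hK.isClosed)
  rintro _ ⟨_, ⟨x, hx, rfl⟩, rfl⟩
  exact ⟨_, subset_closure ⟨_, ⟨x, hx, rfl⟩, rfl⟩, rfl⟩

theorem IsWeaklyCompactOperator.comp_clm {T : F →L[ℂ] G} (hT : IsWeaklyCompactOperator T)
    {S : E →L[ℂ] F} (hS : ‖S‖ ≤ 1) : IsWeaklyCompactOperator (T.comp S) := by
  refine hT.of_isClosed_subset isClosed_closure (closure_mono ?_)
  rintro _ ⟨_, ⟨x, hx, rfl⟩, rfl⟩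
  refine ⟨_, ⟨S x, ?_, rfl⟩, rfl⟩
  rw [mem_closedBall_zero_iff] at hx ⊢
  exact (S.le_of_opNorm_le hS x).trans (by simpa using hx)

/-- Along an ultrafilter, a family in a weakly compact set converges weakly. -/
theorem IsCompact.exists_tendsto_apply_of_toWeakSpace {K : Set (WeakSpace ℂ F)} (hK : IsCompact K)
    {ι : Type*} (U : Ultrafilter ι) {x : ι → F} (hx : ∀ᶠ i in U, toWeakSpace ℂ F (x i) ∈ K) :
    ∃ g : F, toWeakSpace ℂ F g ∈ K ∧ ∀ l : F →L[ℂ] ℂ, Tendsto (fun i => l (x i)) U (𝓝 (l g)) := by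
  obtain ⟨g, hgK, hg⟩ := hK.ultrafilter_le_nhds (U.map fun i => toWeakSpace ℂ F (x i))
    (le_principal_iff.2 hx)
  refine ⟨(toWeakSpace ℂ F).symm g, by simpa using hgK, fun l => ?_⟩
  have hl : Continuous fun y : WeakSpace ℂ F => l ((toWeakSpace ℂ F).symm y) :=
    WeakBilin.eval_continuous (topDualPairing ℂ F).flip l
  exact (hl.tendsto g).comp hg

end WeaklyCompact

/-! ### A gliding hump -/

theorem UnitIco.tendsto_measure_Ici (l : Measure UnitIco) [IsFiniteMeasure l] :
    Tendsto (fun r : UnitIco => l (Ici r)) atTop (𝓝 0) := by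
  have h : ⋂ r : UnitIco, Ici r = ∅ := by
    refine eq_empty_of_forall_notMem fun x hx => ?_
    obtain ⟨y, hy⟩ := exists_gt x
    exact absurd (mem_iInter.1 hx y) (not_le.2 hy)
  have := tendsto_measure_iInter_atTop (μ := l) (s := fun r : UnitIco => Ici r)
    (fun r => measurableSet_Ici.nullMeasurableSet) (fun _ _ h => Ici_subset_Ici.2 h)
    ⟨0, measure_ne_top _ _⟩
  rwa [h, measure_empty] at this

/-- Complex measures that converge to `0` on every Borel set, and in variation on every interval
`[0,r)` with `r < 1`, converge to `0` in norm. -/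
theorem ComplexMeasure.tendsto_enorm_of_tendsto_apply {ν : ℕ → ComplexMeasure UnitIco}
    (h1 : ∀ E, MeasurableSet E → Tendsto (fun n => ν n E) atTop (𝓝 0))
    (h2 : ∀ r : UnitIco, Tendsto (fun n => (ν n).variation (Iio r)) atTop (𝓝 0)) :
    Tendsto (fun n => ‖ν n‖ₑ) atTop (𝓝 0) := by
  by_contra hcon
  rw [ENNReal.tendsto_nhds_zero] at hcon
  push Not at hcon
  obtain ⟨ε, hε, hfreq⟩ := hcon
  have hεt : ε ≠ ∞ := by
    obtain ⟨n, hn⟩ := hfreq.exists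
    exact (hn.trans_le le_top).ne
  -- A hump of size $3\delta$ needs variation above $12\delta$ in the middle block; with head and
  -- tail at most $\delta$ each, norm above $14\delta$ suffices.
  set δ := ε / 16 with hδ
  have hδ0 : 0 < δ := ENNReal.div_pos hε.ne' (by simp)
  have hδt : δ ≠ ∞ := (ENNReal.div_lt_top hεt (by simp)).ne
  have hδε : 16 * δ = ε := ENNReal.mul_div_cancel (by simp) (by simp)
  have step : ∀ (k : ℕ) (r : UnitIco), ∃ (n : ℕ) (r' : UnitIco) (E : Set UnitIco), k ≤ n ∧ r ≤ r' ∧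
      MeasurableSet E ∧ E ⊆ Ico r r' ∧ (ν n).variation (Iio r) ≤ δ ∧
      (ν n).variation (Ici r') ≤ δ ∧ 3 * δ ≤ ‖ν n E‖ₑ := fun k r => by
    obtain ⟨n, hn, hkn, hnr⟩ := (hfreq.and_eventually ((eventually_ge_atTop k).and
      (ENNReal.tendsto_nhds_zero.1 (h2 r) δ hδ0))).exists
    obtain ⟨r', hr', hrr'⟩ := ((ENNReal.tendsto_nhds_zero.1
      (UnitIco.tendsto_measure_Ici (ν n).variation) δ hδ0).and (eventually_ge_atTop r)).exists
    have hlt : 12 * δ < (ν n).variation (Ico r r') := by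
      by_contra! hle
      have hU : (univ : Set UnitIco) = Iio r ∪ Ico r r' ∪ Ici r' := by
        ext x
        simp only [mem_univ, mem_union, mem_Iio, mem_Ico, mem_Ici, true_iff]
        rcases lt_or_ge x r with h | h
        · exact Or.inl (Or.inl h)
        · rcases lt_or_ge x r' with h' | h'
          · exact Or.inl (Or.inr ⟨h, h'⟩)
          · exact Or.inr h'
      have : ‖ν n‖ₑ ≤ ε := by
        rw [ComplexMeasure.enorm_eq, hU, ← hδε]
        calc _ ≤ (ν n).variation (Iio r) + (ν n).variation (Ico r r') + (ν n).variation (Ici r') :=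
              (measure_union_le _ _).trans (by gcongr; exact measure_union_le _ _)
          _ ≤ δ + 12 * δ + δ := by gcongr
          _ = 14 * δ := by ring
          _ ≤ 16 * δ := by gcongr; norm_num
      exact absurd hn (not_lt.2 this)
    obtain ⟨E, hEs, hE, hlt'⟩ := (ν n).exists_subset_lt_enorm_apply measurableSet_Ico hlt
    refine ⟨n, r', E, hkn, hrr', hE, hEs, hnr, hr', ?_⟩
    rw [show (12 : ℝ≥0∞) * δ = 4 * (3 * δ) by ring] at hlt'
    exact (ENNReal.mul_le_mul_iff_right (by simp) (by simp)).1 hlt'.le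
  choose n r' E hn hr hE hEs hlo hhi hbig using step
  let r : ℕ → UnitIco := fun k => Nat.rec 0 (fun k s => r' k s) k
  have hrs : ∀ k, r (k + 1) = r' k (r k) := fun k => rfl
  have hmono : Monotone r := monotone_nat_of_le_succ fun k => by rw [hrs]; exact hr _ _
  set U : Set UnitIco := ⋃ k, E k (r k) with hU
  have hUm : MeasurableSet U := MeasurableSet.iUnion fun k => hE _ _
  -- For the `k`-th chosen measure all other humps lie in its small head or tail and contribute at
  -- most $2\delta$, leaving at least $\delta$ on `U`, against convergence to 0 there.
  have hdiff : ∀ k, U \ E k (r k) ⊆ Iio (r k) ∪ Ici (r' k (r k)) := fun k x hx => by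
    obtain ⟨j, hj⟩ := mem_iUnion.1 hx.1
    have hxj := hEs _ _ hj
    rw [← hrs] at hxj ⊢
    rcases lt_trichotomy j k with h | h | h
    · exact Or.inl (hxj.2.trans_le (hmono h))
    · exact absurd (h ▸ hj) hx.2
    · exact Or.inr ((hmono h).trans hxj.1)
  have hlow : ∀ k, δ ≤ ‖ν (n k (r k)) U‖ₑ := fun k => by
    set ρ := ν (n k (r k))
    have hsub : E k (r k) ⊆ U := subset_iUnion (fun k => E k (r k)) k
    have hadd : ρ (E k (r k)) = ρ U - ρ (U \ E k (r k)) := by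
      rw [eq_sub_iff_add_eq]
      exact VectorMeasure.of_add_of_sdiff (hE _ _) hUm hsub
    have hrest : ‖ρ (U \ E k (r k))‖ₑ ≤ 2 * δ :=
      calc _ ≤ ρ.variation (U \ E k (r k)) := VectorMeasure.enorm_measure_le_variation _ _
        _ ≤ ρ.variation (Iio (r k)) + ρ.variation (Ici (r' k (r k))) :=
          (measure_mono (hdiff k)).trans (measure_union_le _ _)
        _ ≤ δ + δ := add_le_add (hlo _ _) (hhi _ _)
        _ = 2 * δ := by ring
    have h3 : δ + 2 * δ ≤ ‖ρ U‖ₑ + 2 * δ :=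
      calc δ + 2 * δ = 3 * δ := by ring
        _ ≤ ‖ρ (E k (r k))‖ₑ := hbig _ _
        _ ≤ ‖ρ U‖ₑ + ‖ρ (U \ E k (r k))‖ₑ := by rw [hadd]; exact enorm_sub_le
        _ ≤ _ := by gcongr
    exact (ENNReal.add_le_add_iff_right (ENNReal.mul_ne_top (by simp) hδt)).1 h3
  have hlim : Tendsto (fun k => ‖ν (n k (r k)) U‖ₑ) atTop (𝓝 0) := by
    have := (h1 U hUm).enorm.comp (tendsto_atTop_mono (fun k => hn k (r k)) tendsto_id)
    rw [enorm_zero] at this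
    exact this
  exact absurd (ge_of_tendsto' hlim hlow) (not_le.2 hδ0)

/-! ### The measures $t(\delta_t*\mu)$ and their norms -/

namespace LocalComplexMeasure

open UnitIco

/-- The complex measure `t (δ_t * μ)` on `[0,1)`. -/
noncomputable def pointConv (μ : LocalComplexMeasure) (t : UnitIco) : VolterraM :=
  ((t : ℝ) : ℂ) • (μ.restr (below (1 - t))).map (add t)

theorem pointConv_apply (μ : LocalComplexMeasure) (t : UnitIco) {E : Set UnitIco}
    (hE : MeasurableSet E) : μ.pointConv t E = μ.weightedShift E t := by
  change ((t : ℝ) : ℂ) * (μ.restr (below (1 - t))).map (add t) E = _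
  rcases eq_or_lt_of_le (bot_le : (0 : UnitIco) ≤ t) with h0 | h0
  · rw [weightedShift, ← h0]
    simp
  · have hb : BddAbove (below (1 - t)) :=
      bddAbove_below (by have : (0 : ℝ) < t := h0; linarith)
    rw [VectorMeasure.map_apply _ (measurable_add_right t) hE, weightedShift,
      restr_apply _ (measurable_add_right t hE) (measurableSet_below _) hb, shift_eq]
    congr 2
    ext s
    have hs : s ∈ below (1 - (t : ℝ)) ↔ (t : ℝ) + s < 1 := by
      rw [mem_below, lt_sub_iff_add_lt']
    exact and_comm.trans (and_congr_left fun _ => hs)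

namespace IsPolar

variable {μ : LocalComplexMeasure} {m : Measure UnitIco} {h : UnitIco → ℂ} (hp : μ.IsPolar m h)
include hp

theorem variation_pointConv_le (t : UnitIco) {E : Set UnitIco} (hE : MeasurableSet E) :
    (μ.pointConv t).variation E ≤ ENNReal.ofReal t * m (shift t E) := by
  rcases eq_or_lt_of_le (bot_le : (0 : UnitIco) ≤ t) with h0 | h0
  · rw [pointConv, ← h0]
    simp
  · have hb : BddAbove (below (1 - t)) :=
      bddAbove_below (by have : (0 : ℝ) < t := h0; linarith)
    rw [pointConv, VectorMeasure.variation_smul, Measure.smul_apply]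
    change ‖((t : ℝ) : ℂ)‖ₑ * _ ≤ _
    rw [← ofReal_norm, Complex.norm_real, Real.norm_of_nonneg t.2.1]
    refine mul_le_mul_right ?_ _
    refine (VectorMeasure.variation_map_le (μ := μ.restr (below (1 - t))) (φ := add t) E).trans ?_
    rw [Measure.map_apply (measurable_add_right t) hE,
      hp.variation_restr (measurableSet_below _) hb,
      Measure.restrict_apply (measurable_add_right t hE)]
    refine measure_mono fun s hs => ?_
    rw [shift_eq]
    exact ⟨lt_sub_iff_add_lt'.1 hs.2, hs.1⟩

/-- Each value of $t\mu$ on a Borel subset of $[0,1-t)$ is a value of $t(\delta_t*\mu)$ on its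
translate. The factor 4 is not sharp but harmless in the limit. -/
theorem tail_le_enorm_pointConv {t : UnitIco} (h0 : 0 < t) :
    ENNReal.ofReal t * m (below (1 - t)) ≤ 4 * ‖μ.pointConv t‖ₑ := by
  have hb : BddAbove (below (1 - t)) :=
    bddAbove_below (by have : (0 : ℝ) < t := h0; linarith)
  have hv : (((t : ℝ) : ℂ) • μ.restr (below (1 - t))).variation univ =
      ENNReal.ofReal t * m (below (1 - t)) := by
    rw [VectorMeasure.variation_smul, Measure.smul_apply,
      hp.variation_restr (measurableSet_below _) hb, Measure.restrict_apply_univ]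
    change ‖((t : ℝ) : ℂ)‖ₑ * _ = _
    rw [← ofReal_norm, Complex.norm_real, Real.norm_of_nonneg t.2.1]
  rw [← hv]
  refine ComplexMeasure.variation_le_of_forall_subset _ MeasurableSet.univ fun A _ hA => ?_
  set B := A ∩ below (1 - t)
  have hB : MeasurableSet B := hA.inter (measurableSet_below _)
  have hE : MeasurableSet {x | t ≤ x ∧ tsub x t ∈ B} :=
    measurableSet_Ici.inter ((measurable_tsub.comp measurable_prodMk_right) hB)
  have : (((t : ℝ) : ℂ) • μ.restr (below (1 - t))) A =
      μ.pointConv t {x | t ≤ x ∧ tsub x t ∈ B} := by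
    rw [pointConv_apply _ _ hE, weightedShift, shift_image_add t inter_subset_right]
    change ((t : ℝ) : ℂ) * μ.restr (below (1 - t)) A = _
    rw [restr_apply _ hA (measurableSet_below _) hb]
  rw [this, enorm_le_iff_norm_le]
  exact ComplexMeasure.norm_apply_le _ _

end IsPolar

end LocalComplexMeasure

/-! ### Weak compactness forces absolute continuity and a vanishing tail -/

/-- The normalized indicator function of `[a,b)`. -/
noncomputable def VolterraL1.average (a b : UnitIco) : VolterraL1 :=
  indicatorConstLp 1 (measurableSet_Ico (a := a) (b := b)) (measure_ne_top _ _)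
    (((b : ℝ) - a)⁻¹ : ℂ)

theorem UnitIco.measureReal_Ico {a b : UnitIco} (hab : a ≤ b) :
    (volume : Measure UnitIco).real (Ico a b) = b - a := by
  rw [Measure.real, volume_Ico, ENNReal.toReal_ofReal (sub_nonneg.2 hab)]

theorem VolterraL1.norm_average_le {a b : UnitIco} (hab : a < b) : ‖average a b‖ ≤ 1 := by
  have h : (0 : ℝ) < b - a := sub_pos.2 hab
  rw [average, norm_indicatorConstLp one_ne_zero ENNReal.one_ne_top,
    UnitIco.measureReal_Ico hab.le, ← Complex.ofReal_sub, norm_inv, Complex.norm_real,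
    Real.norm_of_nonneg h.le]
  simp [h.ne']

theorem VolterraL1.integral_mul_average {g : UnitIco → ℂ} (a b : UnitIco) :
    ∫ t, g t * average a b t = (∫ t in Ico a b, g t) * ((b : ℝ) - a)⁻¹ := by
  rw [← integral_mul_const, ← integral_indicator measurableSet_Ico]
  refine integral_congr_ae ?_
  filter_upwards [indicatorConstLp_coeFn (p := 1) (hs := measurableSet_Ico (a := a) (b := b))
    (hμs := measure_ne_top volume _) (c := (((b : ℝ) - a)⁻¹ : ℂ))] with t ht
  rw [average, ht]
  by_cases h : t ∈ Ico a b <;> simp [h, -mem_Ico]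

/-- The averages of a right-continuous function over `[a,b)` converge to its value at `a`. -/
theorem VolterraL1.tendsto_integral_mul_average {g : UnitIco → ℂ} {a : UnitIco}
    (hgi : Integrable g) (hg : ContinuousWithinAt g (Ici a) a) :
    Tendsto (fun b => ∫ t, g t * average a b t) (𝓝[>] a) (𝓝 (g a)) := by
  rw [Metric.tendsto_nhds]
  intro ε hε
  have h1 : ∀ᶠ t in 𝓝[≥] a, dist (g t) (g a) < ε / 2 :=
    Metric.tendsto_nhds.1 hg (ε / 2) (half_pos hε)
  obtain ⟨c, hac, hc⟩ := mem_nhdsGE_iff_exists_Ico_subset.1 h1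
  filter_upwards [Ioc_mem_nhdsGT hac] with b hb
  have hpos : (0 : ℝ) < b - a := sub_pos.2 hb.1
  have hne : ((b : ℝ) - a : ℂ) ≠ 0 := by
    rw [← Complex.ofReal_sub]
    exact_mod_cast hpos.ne'
  rw [integral_mul_average, dist_eq_norm, Complex.ofReal_inv, Complex.ofReal_sub]
  have hconst : g a = (∫ _ in Ico a b, g a) * ((b : ℝ) - a : ℂ)⁻¹ := by
    rw [setIntegral_const, UnitIco.measureReal_Ico hb.1.le, Complex.real_smul, mul_right_comm,
      Complex.ofReal_sub, mul_inv_cancel₀ hne, one_mul]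
  rw [hconst, ← sub_mul, ← integral_sub hgi.integrableOn (integrable_const _), norm_mul, norm_inv,
    ← Complex.ofReal_sub, Complex.norm_real, Real.norm_of_nonneg hpos.le]
  have hle := norm_setIntegral_le_of_norm_le_const (μ := volume) (s := Ico a b)
    (f := fun t => g t - g a) (C := ε / 2) (measure_lt_top _ _) fun t ht => by
      rw [← dist_eq_norm]
      exact (hc ⟨ht.1, ht.2.trans_le hb.2⟩).le
  rw [UnitIco.measureReal_Ico hb.1.le] at hle
  rw [← div_eq_mul_inv, div_lt_iff₀ hpos]
  refine hle.trans_lt ?_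
  gcongr
  linarith

namespace LocalComplexMeasure

open UnitIco

namespace IsPolar

variable {μ : LocalComplexMeasure} {m : Measure UnitIco} {h : UnitIco → ℂ} (hp : μ.IsPolar m h)
include hp

/-- As $t\downarrow a$ the sets $[0,x-t)$ increase to $[0,x-a)$. From the left an atom of $\mu$ at
$x-a$ would intervene, which is why the averages are taken over $[a,b)$. -/
theorem continuousWithinAt_weightedShift_below {x : ℝ} (hx : x ≤ 1) {a : UnitIco} (ha : 0 < a) :
    ContinuousWithinAt (μ.weightedShift (below x)) (Ici a) a := by
  have ha' : (0 : ℝ) < a := ha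
  have heq : ∀ t, a ≤ t → μ.weightedShift (below x) t =
      ((t : ℝ) : ℂ) * ∫ s, (below (x - t)).indicator h s ∂m := fun t ht => by
    have hb : BddAbove (below (x - t)) := bddAbove_below (by
      have : (a : ℝ) ≤ t := ht
      linarith)
    rw [weightedShift, shift_below t hx, hp.measureOf_eq _ (measurableSet_below _) hb,
      integral_indicator (measurableSet_below _)]
  refine ContinuousWithinAt.congr ?_ heq (heq a le_rfl)
  refine ContinuousWithinAt.mul (by fun_prop) ?_
  have hb : BddAbove (below (x - a)) := bddAbove_below (by linarith)
  refine tendsto_integral_filter_of_dominated_convergence ((below (x - a)).indicator fun _ => 1)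
    (Eventually.of_forall fun t =>
      (hp.measurable.indicator (measurableSet_below _)).aestronglyMeasurable) ?_ ?_ ?_
  · filter_upwards [self_mem_nhdsWithin] with t ht
    refine Eventually.of_forall fun s => ?_
    have hta : (a : ℝ) ≤ t := ht
    by_cases hs : s ∈ below (x - t)
    · have hs' : s ∈ below (x - a) := below_mono (by linarith) hs
      rw [indicator_of_mem hs, indicator_of_mem hs', hp.norm_eq_one]
    · rw [indicator_of_notMem hs, norm_zero]
      exact indicator_nonneg (fun _ _ => zero_le_one) _
  · rw [integrable_indicator_iff (measurableSet_below _)]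
    have := hp.isFiniteMeasure_restrict hb
    exact integrable_const _
  · refine Eventually.of_forall fun s => tendsto_nhds_of_eventually_eq ?_
    by_cases hs : s ∈ below (x - a)
    · have hs' : (a : ℝ) < x - s := by rw [mem_below] at hs; linarith
      have : ∀ᶠ t : UnitIco in 𝓝[≥] a, (t : ℝ) < x - s :=
        (continuous_subtype_val.tendsto a).eventually_lt_const hs' |>.filter_mono
          nhdsWithin_le_nhds
      filter_upwards [this] with t ht
      rw [indicator_of_mem hs, indicator_of_mem (by rw [mem_below]; linarith)]
    · filter_upwards [self_mem_nhdsWithin] with t ht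
      have hta : (a : ℝ) ≤ t := ht
      rw [indicator_of_notMem hs,
        indicator_of_notMem fun hc => hs (below_mono (by linarith) hc)]

variable {C : ℝ} (hC : ∀ t : ℝ, 0 < t → t < 1 →
  ENNReal.ofReal t * m (below (1 - t)) ≤ ENNReal.ofReal C)
include hC

/-- The measure `a (δ_a * μ)` is absolutely continuous and lies in the weak closure of the image
of the unit ball of `L¹[0,1)`, if that closure is weakly compact. -/
theorem pointConv_mem_closure {D : VolterraL1 →L[ℂ] VolterraL1} {Dbar : VolterraM →L[ℂ] VolterraM}
    (hDbar : IsVolterraMeasureDerivation μ Dbar)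
    (hD : ∀ f, VolterraL1.toMeasure (D f) = Dbar (VolterraL1.toMeasure f))
    {T : VolterraL1 →L[ℂ] VolterraM} (hTD : ∀ f, T f = Dbar (VolterraL1.toMeasure f))
    (hT : IsWeaklyCompactOperator T) {a : UnitIco} (ha : 0 < a) :
    toWeakSpace ℂ VolterraM (μ.pointConv a) ∈
        closure (toWeakSpace ℂ VolterraM '' (T '' Metric.closedBall 0 1)) ∧
      ∀ E, MeasurableSet E → volume E = 0 → μ.pointConv a E = 0 := by
  obtain ⟨g, hgK, hg⟩ := IsCompact.exists_tendsto_apply_of_toWeakSpace hT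
    (Ultrafilter.of (𝓝[>] a)) (x := fun b => T (VolterraL1.average a b)) (by
      have : ∀ᶠ b in 𝓝[>] a, toWeakSpace ℂ VolterraM (T (VolterraL1.average a b)) ∈
          closure (toWeakSpace ℂ VolterraM '' (T '' Metric.closedBall 0 1)) := by
        filter_upwards [self_mem_nhdsWithin] with b hb
        exact subset_closure ⟨_, ⟨_, mem_closedBall_zero_iff.2
          (VolterraL1.norm_average_le hb), rfl⟩, rfl⟩
      exact this.filter_mono (Ultrafilter.of_le _))
  -- The weak limit is identified on intervals $[0,x)$ only, where the averages are known to
  -- converge.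
  have hgeq : g = μ.pointConv a := ext_of_below fun x hx => by
    have h1 := hg (ComplexMeasure.evalCLM (below x))
    simp only [ComplexMeasure.evalCLM_apply, hTD,
      hp.measureDerivation_toMeasure hC hDbar _ (measurableSet_below x)] at h1
    have h2 := VolterraL1.tendsto_integral_mul_average
      (hp.integrable_weightedShift hC (measurableSet_below x) volume)
      (hp.continuousWithinAt_weightedShift_below hx ha)
    rw [pointConv_apply _ _ (measurableSet_below x)]
    exact tendsto_nhds_unique h1 (h2.mono_left (Ultrafilter.of_le _))
  rw [← hgeq]
  refine ⟨hgK, fun E hE h0 => ?_⟩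
  -- Evaluation on the null set `E` is a bounded functional that vanishes on every image `T f`.
  have h1 := hg (ComplexMeasure.evalCLM E)
  simp only [ComplexMeasure.evalCLM_apply, hTD, ← hD,
    VolterraL1.toMeasure_apply_of_volume_eq_zero _ hE h0] at h1
  exact tendsto_nhds_unique h1 tendsto_const_nhds

omit hp hC in
-- For `A` bounded above by `b`, any `c > b` gives $a=1-c>0$ with $A\subseteq[0,1-a)$; the translate
-- $A+a$ is again null and $a(\delta_a*\mu)(A+a)=a\,\mu(A)$.
theorem isAbsolutelyContinuous_of_pointConv
    (hac : ∀ a : UnitIco, 0 < a → ∀ E, MeasurableSet E → volume E = 0 → μ.pointConv a E = 0) :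
    μ.IsAbsolutelyContinuous := by
  rintro A hA ⟨b, hb⟩ h0
  obtain ⟨c, hbc⟩ := exists_gt b
  have hb1 : (b : ℝ) < c := hbc
  have hc1 := c.2.2
  set a : UnitIco := ⟨1 - c, by linarith, by linarith [b.2.1]⟩ with ha
  have ha0 : 0 < a := by
    change (0 : ℝ) < 1 - c
    linarith
  have hAa : A ⊆ below (1 - a) := fun s hs => by
    have : (s : ℝ) ≤ b := hb hs
    rw [mem_below]
    simp only [ha]
    linarith
  have hE : MeasurableSet {x | a ≤ x ∧ tsub x a ∈ A} :=
    measurableSet_Ici.inter ((measurable_tsub.comp measurable_prodMk_right) hA)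
  have hz : volume {x | a ≤ x ∧ tsub x a ∈ A} = 0 := by
    have h1 := (measurePreserving_tsub a).measure_preimage hA.nullMeasurableSet
    rw [Measure.restrict_apply ((measurePreserving_tsub a).measurable hA),
      Measure.restrict_apply hA, measure_mono_null inter_subset_left h0] at h1
    rwa [inter_comm] at h1
  have h2 := hac a ha0 _ hE hz
  rw [pointConv_apply _ _ hE, weightedShift, shift_image_add a hAa] at h2
  refine (mul_eq_zero.1 h2).resolve_left ?_
  have : (a : ℝ) ≠ 0 := (show (0 : ℝ) < a from ha0).ne'
  exact_mod_cast this

omit hC in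
theorem tendsto_tailFun_of_pointConv_mem {K : Set (WeakSpace ℂ VolterraM)} (hK : IsCompact K)
    (hmem : ∀ a : UnitIco, 0 < a → toWeakSpace ℂ VolterraM (μ.pointConv a) ∈ K) :
    Tendsto μ.tailFun (𝓝[>] 0) (𝓝 0) := by
  have hcoe : Tendsto (fun a : UnitIco => ENNReal.ofReal a) (𝓝[>] 0) (𝓝 0) := by
    have : Tendsto (fun a : UnitIco => ENNReal.ofReal a) (𝓝 0) (𝓝 (ENNReal.ofReal (0 : UnitIco))) :=
      (ENNReal.continuous_ofReal.comp continuous_subtype_val).tendsto 0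
    rw [show ((0 : UnitIco) : ℝ) = 0 from rfl, ENNReal.ofReal_zero] at this
    exact this.mono_left nhdsWithin_le_nhds
  -- The mass escapes towards 1: on $[0,r)$ the variation is at most $a\,m([0,r])$.
  have hvar : ∀ r : UnitIco,
      Tendsto (fun a => (μ.pointConv a).variation (Iio r)) (𝓝[>] 0) (𝓝 0) := fun r => by
    have h0 : Tendsto (fun a : UnitIco => ENNReal.ofReal a * m (Iic r)) (𝓝[>] 0) (𝓝 0) := by
      have := ENNReal.Tendsto.mul_const (b := m (Iic r)) hcoe
        (Or.inr (hp.measure_Iic_lt_top r).ne)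
      rwa [zero_mul] at this
    refine tendsto_of_tendsto_of_tendsto_of_le_of_le tendsto_const_nhds h0 (fun _ => zero_le)
      fun a => (hp.variation_pointConv_le a measurableSet_Iio).trans ?_
    rw [← below_coe, shift_below a r.2.2.le]
    refine mul_le_mul_right (measure_mono ?_) _
    exact (below_mono (by linarith [a.2.1])).trans (Iio_subset_Iic_self (a := r))
  -- Every weak limit `g` along an ultrafilter vanishes on all $[0,r)$; by countable additivity it
  -- has no mass left at the end 1, so `g = 0`.
  have hweak : ∀ l : VolterraM →L[ℂ] ℂ, Tendsto (fun a => l (μ.pointConv a)) (𝓝[>] 0) (𝓝 0) := by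
    intro l
    rw [tendsto_iff_ultrafilter]
    intro U hU
    obtain ⟨g, -, hg⟩ := hK.exists_tendsto_apply_of_toWeakSpace U (x := μ.pointConv) (by
      filter_upwards [hU self_mem_nhdsWithin] with a ha using hmem a ha)
    have hgI : ∀ r : UnitIco, g (Iio r) = 0 := fun r => by
      refine tendsto_nhds_unique (hg (ComplexMeasure.evalCLM (Iio r))) ?_
      rw [tendsto_zero_iff_enorm_tendsto_zero]
      exact tendsto_of_tendsto_of_tendsto_of_le_of_le tendsto_const_nhds ((hvar r).mono_left hU)
        (fun _ => zero_le) fun a => VectorMeasure.enorm_measure_le_variation _ _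
    have hguniv : g univ = 0 := by
      have h1 : Tendsto (fun r : UnitIco => g (Ici r)) atTop (𝓝 0) := by
        rw [tendsto_zero_iff_enorm_tendsto_zero]
        exact tendsto_of_tendsto_of_tendsto_of_le_of_le tendsto_const_nhds
          (tendsto_measure_Ici g.variation) (fun _ => zero_le)
          fun a => VectorMeasure.enorm_measure_le_variation _ _
      have h2 : ∀ r : UnitIco, g (Ici r) = g univ := fun r => by
        rw [← compl_Iio, VectorMeasure.of_compl measurableSet_Iio, hgI, sub_zero]
      simp_rw [h2] at h1
      exact tendsto_nhds_unique tendsto_const_nhds h1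
    have hg0 : g = 0 := by
      refine VectorMeasure.ext_of_generateFrom (range Iio) ?_ ?_ isPiSystem_Iio hguniv
      · rintro _ ⟨r, rfl⟩
        exact hgI r
      · rw [BorelSpace.measurable_eq (α := UnitIco), borel_eq_generateFrom_Iio]
    have := hg l
    rwa [hg0, map_zero] at this
  have hnorm : Tendsto (fun a => ‖μ.pointConv a‖ₑ) (𝓝[>] 0) (𝓝 0) := by
    refine tendsto_of_seq_tendsto fun u hu => ?_
    refine ComplexMeasure.tendsto_enorm_of_tendsto_apply (fun E _ => ?_) fun r => ?_
    · exact (hweak (ComplexMeasure.evalCLM E)).comp hu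
    · exact (hvar r).comp hu
  rw [ENNReal.tendsto_nhds_zero] at hnorm ⊢
  intro ε hε
  have h4 : 0 < ε / 4 := ENNReal.div_pos hε.ne' (by simp)
  obtain ⟨δ, hδ, hsub⟩ := mem_nhdsGT_iff_exists_Ioo_subset.1 (hnorm _ h4)
  have hδ' : (0 : ℝ) < δ := hδ
  filter_upwards [Ioo_mem_nhdsGT hδ'] with t ht
  have ht1 : t < 1 := ht.2.trans δ.2.2
  have h1 := hsub (show (⟨t, ht.1.le, ht1⟩ : UnitIco) ∈ Ioo 0 δ from ⟨ht.1, ht.2⟩)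
  rw [hp.tailFun_eq ht.1]
  refine (hp.tail_le_enorm_pointConv (t := ⟨t, ht.1.le, ht1⟩) ht.1).trans ?_
  calc _ ≤ 4 * (ε / 4) := mul_le_mul_right h1 _
    _ = ε := ENNReal.mul_div_cancel (by simp) (by simp)

end IsPolar

end LocalComplexMeasure

/-! ### Compactness for absolutely continuous measures with vanishing tail -/

namespace UnitIco

theorem isCompact_Iic (c : UnitIco) : IsCompact (Iic c) := by
  rw [Topology.IsEmbedding.subtypeVal.isCompact_iff]
  have : (Subtype.val '' Iic c : Set ℝ) = Icc (0 : ℝ) c := by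
    ext x
    constructor
    · rintro ⟨y, hy, rfl⟩
      exact ⟨y.2.1, hy⟩
    · intro hx
      exact ⟨⟨x, hx.1, hx.2.trans_lt c.2.2⟩, hx.2, rfl⟩
  rw [this]
  exact isCompact_Icc

theorem volume_singleton (t : UnitIco) : volume ({t} : Set UnitIco) = 0 := by
  rw [volume_eq, image_singleton, Real.volume_singleton]

/-- The function `x ↦ t w(x - t)` on `[t,1)`, extended by `0`. -/
noncomputable def weightedTranslate (w : UnitIco → ℂ) (t : UnitIco) : UnitIco → ℂ :=
  (Ici t).indicator fun x => ((t : ℝ) : ℂ) * w (tsub x t)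

theorem measurable_tsub_right (t : UnitIco) : Measurable fun x => tsub x t :=
  measurable_tsub.comp measurable_prodMk_right

theorem measurable_translate {w : UnitIco → ℂ} (hw : Measurable w) (t : UnitIco) :
    Measurable (weightedTranslate w t) :=
  Measurable.indicator ((hw.comp (measurable_tsub_right t)).const_mul _) measurableSet_Ici

theorem enorm_coe (t : UnitIco) : ‖((t : ℝ) : ℂ)‖ₑ = ENNReal.ofReal t := by
  rw [← ofReal_norm, Complex.norm_real, Real.norm_of_nonneg t.2.1]

theorem below_one_sub (t : UnitIco) : below (1 - t) = {u : UnitIco | (u : ℝ) + t < 1} := by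
  ext u
  rw [mem_below, lt_sub_iff_add_lt]
  rfl

theorem lintegral_translate {w : UnitIco → ℂ} (hw : Measurable w) (t : UnitIco) :
    ∫⁻ x, ‖weightedTranslate w t x‖ₑ = ENNReal.ofReal t * ∫⁻ u in below (1 - t), ‖w u‖ₑ := by
  have h : ∀ x, ‖weightedTranslate w t x‖ₑ =
      (Ici t).indicator (fun x => ENNReal.ofReal t * ‖w (tsub x t)‖ₑ) x := fun x => by
    rw [weightedTranslate, enorm_indicator_eq_indicator_enorm]
    simp_rw [enorm_mul, enorm_coe]
  simp_rw [h]
  rw [lintegral_indicator measurableSet_Ici, lintegral_const_mul'' _ (by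
      exact (hw.comp (measurable_tsub_right t)).enorm.aemeasurable), below_one_sub,
    ← (measurePreserving_tsub t).lintegral_comp hw.enorm]

theorem setIntegral_translate {w : UnitIco → ℂ} (hw : Measurable w) (t : UnitIco)
    {E : Set UnitIco} (hE : MeasurableSet E) :
    ∫ x in E, weightedTranslate w t x = ((t : ℝ) : ℂ) * ∫ u in shift t E, w u := by
  have hs : MeasurableSet {u : UnitIco | (u : ℝ) + t < 1} :=
    measurableSet_add_lt.preimage measurable_prodMk_right
  have hA : Measurable ((shift t E).indicator w) := hw.indicator (measurableSet_shift t hE)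
  have h1 : ∀ x, E.indicator (weightedTranslate w t) x =
      (Ici t).indicator (fun x => ((t : ℝ) : ℂ) * (shift t E).indicator w (tsub x t)) x :=
    fun x => by
    by_cases hx : t ≤ x
    · have hmem : tsub x t ∈ shift t E ↔ x ∈ E := by
        constructor
        · rintro ⟨y, hy, hyx⟩
          rw [coe_tsub_of_le hx, sub_add_cancel] at hyx
          rwa [← Subtype.ext hyx]
        · intro hxE
          exact ⟨x, hxE, by rw [coe_tsub_of_le hx, sub_add_cancel]⟩
      by_cases hxE : x ∈ E
      · simp [weightedTranslate, indicator, hx, hxE, hmem.2 hxE]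
      · simp [indicator, hx, hxE, mt hmem.1 hxE]
    · simp [weightedTranslate, indicator, hx]
  rw [← integral_indicator hE]
  simp_rw [h1]
  rw [integral_indicator measurableSet_Ici, integral_const_mul,
    ← integral_indicator (measurableSet_shift t hE)]
  congr 1
  rw [← integral_map (φ := fun x => tsub x t) (f := (shift t E).indicator w)
    (measurePreserving_tsub t).measurable.aemeasurable hA.aestronglyMeasurable,
    (measurePreserving_tsub t).map_eq]
  refine setIntegral_eq_integral_of_forall_compl_eq_zero fun u hu => ?_
  refine indicator_of_notMem (fun hc => hu ?_) _
  rw [← below_one_sub]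
  exact shift_subset t E hc

/-- By dominated convergence; the jump of the cut-off to $[t,1)$ spoils pointwise convergence at
most at $x=a$, a null set. -/
theorem continuous_translate_lintegral (g : BoundedContinuousFunction UnitIco ℂ) (a : UnitIco) :
    Tendsto (fun t => ∫⁻ x, ‖weightedTranslate g t x - weightedTranslate g a x‖ₑ) (𝓝 a) (𝓝 0) := by
  have hgm : Measurable g := g.continuous.measurable
  have hlim : ∫⁻ _ : UnitIco, (0 : ℝ≥0∞) = 0 := lintegral_zero
  rw [← hlim]
  have hb : ∀ t x, ‖weightedTranslate g t x‖ₑ ≤ ‖g‖ₑ := fun t x => by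
    rw [weightedTranslate, enorm_indicator_eq_indicator_enorm]
    refine (indicator_le_self _ _ _).trans ?_
    rw [enorm_mul, enorm_coe]
    refine (mul_le_mul' (ENNReal.ofReal_le_one.2 t.2.2.le) ?_).trans_eq (one_mul _)
    rw [enorm_le_iff_norm_le]
    exact g.norm_coe_le_norm _
  refine tendsto_lintegral_filter_of_dominated_convergence (fun _ => ‖g‖ₑ + ‖g‖ₑ)
    (Eventually.of_forall fun t =>
      ((measurable_translate hgm t).sub (measurable_translate hgm a)).enorm)
    (Eventually.of_forall fun t => Eventually.of_forall fun x =>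
      enorm_sub_le.trans (add_le_add (hb t x) (hb a x))) 
    (by rw [lintegral_const]; exact ENNReal.mul_ne_top (by simp) (measure_ne_top _ _)) ?_
  have hne : ∀ᵐ x : UnitIco, x ≠ a := by
    rw [ae_iff]
    simpa using volume_singleton a
  filter_upwards [hne] with x hx
  have hcont : ContinuousAt (fun t : UnitIco => weightedTranslate g t x) a := by
    rcases lt_or_gt_of_ne hx with h | h
    · refine continuousAt_const.congr (f := fun _ => (0 : ℂ)) ?_
      filter_upwards [lt_mem_nhds h] with t ht
      rw [weightedTranslate, indicator_of_notMem (by simpa using ht)]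
    · have hc : Continuous fun t : UnitIco => ((t : ℝ) : ℂ) * g (tsub x t) := by
        refine Continuous.mul (by fun_prop) (g.continuous.comp ?_)
        unfold tsub
        fun_prop
      refine hc.continuousAt.congr ?_
      filter_upwards [gt_mem_nhds h] with t ht
      rw [weightedTranslate, indicator_of_mem (show x ∈ Ici t from le_of_lt ht)]
  have := (hcont.sub_const (weightedTranslate g a x)).enorm
  simpa [ContinuousAt] using this

end UnitIco

namespace LocalComplexMeasure

open UnitIco

namespace IsPolar

variable {μ : LocalComplexMeasure} {m : Measure UnitIco} {h : UnitIco → ℂ} (hp : μ.IsPolar m h)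
include hp

theorem absolutelyContinuous_volume (hac : μ.IsAbsolutelyContinuous) : m ≪ volume := by
  refine Measure.AbsolutelyContinuous.mk fun A hA h0 => ?_
  have hA' : A = ⋃ n, A ∩ pieceIndex ⁻¹' {n} := by
    rw [← inter_iUnion, eq_comm, inter_eq_left]
    exact fun x _ => mem_iUnion.2 ⟨pieceIndex x, rfl⟩
  rw [hA']
  refine measure_iUnion_null fun n => ?_
  have hm := hA.inter (measurable_pieceIndex (measurableSet_singleton n))
  have hb := (bddAbove_piece n).mono (inter_subset_right (s := A))
  rw [← hp.totalVar_eq hm hb, totalVar, VectorMeasure.variation_apply_eq_zero MeasurableSet.univ]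
  intro B _ hB
  rw [restr_apply _ hB hm hb]
  exact hac _ (hB.inter hm) (hb.mono inter_subset_right)
    (measure_mono_null (inter_subset_right.trans inter_subset_left) h0)

/-- The density is $(dm/dx)\,h$. It may fail to be integrable on all of $[0,1)$, so the complex
formula is confined to bounded sets. -/
theorem exists_density (hac : μ.IsAbsolutelyContinuous) :
    ∃ d : UnitIco → ℂ, Measurable d ∧ (∀ A, MeasurableSet A → ∫⁻ x in A, ‖d x‖ₑ = m A) ∧
      ∀ A, MeasurableSet A → BddAbove A → μ.measureOf A = ∫ x in A, d x := by
  have := hp.sigmaFinite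
  have hm := hp.measurable
  set ρ := m.rnDeriv volume
  have hρm : Measurable ρ := Measure.measurable_rnDeriv _ _
  have hρ : volume.withDensity ρ = m :=
    Measure.withDensity_rnDeriv_eq _ _ (hp.absolutelyContinuous_volume hac)
  have hfin : ∀ᵐ x, ρ x < ∞ := Measure.rnDeriv_lt_top _ _
  refine ⟨fun x => (ρ x).toReal • h x, by fun_prop, fun A hA => ?_, fun A hA hAb => ?_⟩
  · rw [← hρ, withDensity_apply _ hA]
    refine lintegral_congr_ae (ae_restrict_of_ae ?_)
    filter_upwards [hfin] with x hx
    rw [enorm_smul, ← ofReal_norm (h x), hp.norm_eq_one, ENNReal.ofReal_one, mul_one,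
      Real.enorm_of_nonneg ENNReal.toReal_nonneg, ENNReal.ofReal_toReal hx.ne]
  · rw [hp.measureOf_eq A hA hAb]
    conv_lhs => rw [← hρ]
    rw [restrict_withDensity hA,
      integral_withDensity_eq_integral_toReal_smul₀ hρm.aemeasurable (ae_restrict_of_ae hfin)]

/-- If `μ` is absolutely continuous and its tail vanishes, `t ↦ t (δ_t * μ)` is a continuous
family of `L¹` functions whose range is totally bounded. -/
theorem exists_continuous_pointConv (hac : μ.IsAbsolutelyContinuous)
    (htail : Tendsto μ.tailFun (𝓝[>] 0) (𝓝 0)) :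
    ∃ φ : UnitIco → VolterraL1, Continuous φ ∧ TotallyBounded (range φ) ∧
      ∀ t E, MeasurableSet E → VolterraL1.toMeasure (φ t) E = μ.weightedShift E t := by
  obtain ⟨d, hdm, hdn, hd⟩ := hp.exists_density hac
  have hlin : ∀ t, ∫⁻ x, ‖weightedTranslate d t x‖ₑ = ENNReal.ofReal t * m (below (1 - t)) := fun t => by
    rw [lintegral_translate hdm, hdn _ (measurableSet_below _)]
  have hb : ∀ {t : UnitIco}, 0 < t → BddAbove (below (1 - t)) := fun {t} ht =>
    bddAbove_below (by have : (0 : ℝ) < t := ht; linarith)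
  have hint : ∀ t, Integrable (weightedTranslate d t) := fun t => by
    refine ⟨(measurable_translate hdm t).aestronglyMeasurable, ?_⟩
    change ∫⁻ x, ‖weightedTranslate d t x‖ₑ < ∞
    rw [hlin]
    rcases eq_or_lt_of_le (bot_le : (0 : UnitIco) ≤ t) with h0 | h0
    · rw [← h0]
      simp
    · exact ENNReal.mul_lt_top ENNReal.ofReal_lt_top (hp.measure_lt_top (hb h0))
  set φ : UnitIco → VolterraL1 := fun t => (hint t).toL1 with hφ
  have hφn : ∀ t, ‖φ t‖ₑ = ENNReal.ofReal t * m (below (1 - t)) := fun t => by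
    rw [← hlin, ← edist_zero_right, ← Integrable.toL1_zero (integrable_zero UnitIco ℂ volume),
      Integrable.edist_toL1_toL1]
    simp [edist_zero_right]
  have hzero : ∀ ε > 0, ∀ᶠ t in 𝓝 (0 : UnitIco), ‖φ t‖ₑ ≤ ε := fun ε hε => by
    obtain ⟨δ, hδ, hsub⟩ := mem_nhdsGT_iff_exists_Ioo_subset.1
      (ENNReal.tendsto_nhds_zero.1 htail ε hε)
    have : ∀ᶠ t : UnitIco in 𝓝 0, (t : ℝ) < δ :=
      (continuous_subtype_val.tendsto (0 : UnitIco)).eventually_lt_const hδ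
    filter_upwards [this] with t ht
    rw [hφn]
    rcases eq_or_lt_of_le (bot_le : (0 : UnitIco) ≤ t) with h0 | h0
    · rw [← h0]
      simp
    · rw [← hp.tailFun_eq h0]
      exact hsub ⟨h0, ht⟩
  -- As $t\to1$ the intervals $[0,1-t)$ shrink to $\{0\}$, which carries no mass by absolute
  -- continuity.
  have htop : Tendsto (fun t => ‖φ t‖ₑ) atTop (𝓝 0) := by
    have h1 : Tendsto (fun t : UnitIco => m (below (1 - t))) atTop (𝓝 0) := by
      have he : ⋂ t : UnitIco, below (1 - t) = {0} := by
        ext x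
        rw [mem_iInter, mem_singleton_iff]
        constructor
        · intro hx
          by_contra h0
          have hpos : (0 : ℝ) < x := bot_lt_iff_ne_bot.2 h0
          have h1 := hx ⟨1 - x, by linarith [x.2.2], by linarith⟩
          rw [mem_below] at h1
          simp at h1
        · rintro rfl t
          rw [mem_below]
          simpa using t.2.2
      have h2 := tendsto_measure_iInter_atTop (μ := m) (s := fun t : UnitIco => below (1 - t))
        (fun t => (measurableSet_below _).nullMeasurableSet)
        (fun s t (hst : (s : ℝ) ≤ t) => below_mono (by linarith))
        (by
          obtain ⟨t, ht⟩ := exists_gt (0 : UnitIco)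
          exact ⟨t, (hp.measure_lt_top (hb ht)).ne⟩)
      rwa [he, hp.absolutelyContinuous_volume hac (volume_singleton 0)] at h2
    refine tendsto_of_tendsto_of_tendsto_of_le_of_le tendsto_const_nhds h1 (fun _ => zero_le)
      fun t => ?_
    simp only [hφn]
    exact mul_le_of_le_one_left zero_le (ENNReal.ofReal_le_one.2 t.2.2.le)
  have hcont : Continuous φ := by
    rw [continuous_iff_continuousAt]
    intro a
    rw [ContinuousAt, EMetric.tendsto_nhds]
    intro ε hε
    rcases eq_or_lt_of_le (bot_le : (0 : UnitIco) ≤ a) with h0 | h0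
    · have hφ0 : φ a = 0 := by
        rw [← enorm_eq_zero, hφn, ← h0]
        simp
      obtain ⟨ε', hε', hlt⟩ := exists_between hε
      have hz : ∀ᶠ t in 𝓝 a, ‖φ t‖ₑ ≤ ε' := by
        rw [← h0]
        exact hzero ε' hε'
      filter_upwards [hz] with t ht
      rw [hφ0, edist_zero_right]
      exact ht.trans_lt hlt
    · obtain ⟨b, hb0, hba⟩ := exists_between h0
      -- The minimum with 1 keeps `η` finite when `ε = ∞`; the strict inequality $3\eta<4\eta$ below
      -- needs this.
      set η := min (ε / 4) 1 with hη
      have hη0 : η ≠ 0 := by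
        rw [hη]
        exact (lt_min (ENNReal.div_pos hε.ne' (by simp)) one_pos).ne'
      have hηt : η ≠ ∞ := (min_le_right _ _).trans_lt ENNReal.one_lt_top |>.ne
      have hdi : Integrable ((below (1 - b)).indicator d) := by
        refine ⟨(hdm.indicator (measurableSet_below _)).aestronglyMeasurable, ?_⟩
        change ∫⁻ x, ‖(below (1 - b)).indicator d x‖ₑ < ∞
        simp_rw [enorm_indicator_eq_indicator_enorm]
        rw [lintegral_indicator (measurableSet_below _), hdn _ (measurableSet_below _)]
        exact hp.measure_lt_top (hb hb0)
      -- For $t\ge b$ only the values of `d` on $[0,1-b)$ enter, where `d` is integrable and so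
      -- approximable in $L^1$ by a bounded continuous function.
      obtain ⟨g, hg, -⟩ := hdi.exists_boundedContinuous_lintegral_sub_le hη0
      have hgm : Measurable g := g.continuous.measurable
      have happ : ∀ t, b ≤ t → ∫⁻ x, ‖weightedTranslate d t x - weightedTranslate g t x‖ₑ ≤ η := fun t ht => by
        have h1 : ∀ x, weightedTranslate d t x - weightedTranslate g t x = weightedTranslate (d - g) t x := fun x => by
          by_cases hx : t ≤ x <;> simp [weightedTranslate, indicator, hx, mul_sub]
        simp_rw [h1]
        rw [lintegral_translate (hdm.sub hgm)]
        refine (mul_le_of_le_one_left zero_le (ENNReal.ofReal_le_one.2 t.2.2.le)).trans ?_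
        calc ∫⁻ u in below (1 - t), ‖(d - g) u‖ₑ
            ≤ ∫⁻ u in below (1 - b), ‖(d - g) u‖ₑ :=
              lintegral_mono_set (below_mono (by have : (b : ℝ) ≤ t := ht; linarith))
          _ = ∫⁻ u in below (1 - b), ‖(below (1 - b)).indicator d u - g u‖ₑ :=
              setLIntegral_congr_fun (measurableSet_below _) fun u hu => by
                simp [indicator_of_mem hu]
          _ ≤ _ := (setLIntegral_le_lintegral _ _).trans hg
      filter_upwards [ENNReal.tendsto_nhds_zero.1 (continuous_translate_lintegral g a) η
        (pos_iff_ne_zero.2 hη0), lt_mem_nhds hba] with t ht hbt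
      rw [hφ]
      simp only
      rw [Integrable.edist_toL1_toL1]
      calc ∫⁻ x, edist (weightedTranslate d t x) (weightedTranslate d a x)
          ≤ ∫⁻ x, (‖weightedTranslate d t x - weightedTranslate g t x‖ₑ +
              ‖weightedTranslate g t x - weightedTranslate g a x‖ₑ + ‖weightedTranslate d a x - weightedTranslate g a x‖ₑ) := by
            refine lintegral_mono fun x => ?_
            refine (edist_triangle4 _ (weightedTranslate g t x) (weightedTranslate g a x) _).trans_eq ?_
            rw [edist_eq_enorm_sub, edist_eq_enorm_sub, edist_comm, edist_eq_enorm_sub]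
        _ ≤ η + η + η := by
            rw [lintegral_add_left, lintegral_add_left]
            · exact add_le_add (add_le_add (happ t hbt.le) ht) (happ a hba.le)
            · exact ((measurable_translate hdm t).sub (measurable_translate hgm t)).enorm
            · exact ((measurable_translate hdm t).sub (measurable_translate hgm t)).enorm.add
                ((measurable_translate hgm t).sub (measurable_translate hgm a)).enorm
        _ = 3 * η := by ring
        _ < 4 * η := ENNReal.mul_lt_mul_left hη0 hηt (by norm_num)
        _ ≤ 4 * (ε / 4) := mul_le_mul_right (min_le_left _ _) _
        _ = ε := ENNReal.mul_div_cancel (by simp) (by simp)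
  refine ⟨φ, hcont, ?_, fun t E hE => ?_⟩
  · rw [EMetric.totallyBounded_iff]
    intro ε hε
    obtain ⟨ε', hε', hlt⟩ := exists_between hε
    -- Beyond `c` one ball around 0 covers the range; on $[0,c]$ it is compact.
    obtain ⟨c, hc⟩ := eventually_atTop.1 (ENNReal.tendsto_nhds_zero.1 htop ε' hε')
    obtain ⟨F, hF, hcov⟩ := EMetric.totallyBounded_iff.1
      ((isCompact_Iic c).image hcont).totallyBounded ε hε
    refine ⟨insert 0 F, hF.insert 0, ?_⟩
    rintro _ ⟨t, rfl⟩
    rcases le_total t c with h1 | h1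
    · exact biUnion_mono (subset_insert 0 F) (fun _ _ => subset_rfl) (hcov ⟨t, h1, rfl⟩)
    · refine mem_biUnion (mem_insert 0 F) ?_
      rw [Metric.mem_eball, edist_zero_right]
      exact (hc t h1).trans_lt hlt
  · rw [VolterraL1.toMeasure_apply _ hE]
    rw [setIntegral_congr_ae hE (g := weightedTranslate d t)
      ((hint t).coeFn_toL1.mono fun x hx _ => hx), setIntegral_translate hdm t hE]
    rcases eq_or_lt_of_le (bot_le : (0 : UnitIco) ≤ t) with h0 | h0
    · rw [weightedShift, ← h0]
      simp
    · rw [weightedShift, hd _ (measurableSet_shift t hE) (bddAbove_shift h0 E)]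

/-- With the polar density `k` of `ν`, the image of `ν` is the Bochner integral of $k\varphi$
against $|\nu|$. For $\|\nu\|\le1$ this is at most a unit multiple of an average of points of the
compact convex set `Q`, which contains 0. -/
theorem isCompactOperator_measureDerivation {C : ℝ} (hC : ∀ t : ℝ, 0 < t → t < 1 →
      ENNReal.ofReal t * m (below (1 - t)) ≤ ENNReal.ofReal C) (hac : μ.IsAbsolutelyContinuous)
    (htail : Tendsto μ.tailFun (𝓝[>] 0) (𝓝 0)) {Dbar : VolterraM →L[ℂ] VolterraM}
    (hD : IsVolterraMeasureDerivation μ Dbar) : IsCompactOperator Dbar := by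
  obtain ⟨φ, hφ, hφtb, hφE⟩ := hp.exists_continuous_pointConv hac htail
  set A : Set VolterraL1 := (fun p : ℂ × VolterraL1 => p.1 • p.2) ''
    (Metric.closedBall (0 : ℂ) 1 ×ˢ closure (range φ))
  have hA : IsCompact A :=
    ((isCompact_closedBall _ _).prod (hφtb.closure.isCompact_of_isClosed isClosed_closure)).image
      continuous_smul
  set Q := closure (convexHull ℝ A)
  have hQ : IsCompact Q :=
    hA.totallyBounded.convexHull.closure.isCompact_of_isClosed isClosed_closure
  have hQc : Convex ℝ Q := (convex_convexHull ℝ A).closure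
  have hAQ : A ⊆ Q := (subset_convexHull ℝ A).trans subset_closure
  have hmem : ∀ (z : ℂ) (t : UnitIco), ‖z‖ ≤ 1 → z • φ t ∈ Q := fun z t hz =>
    hAQ ⟨(z, φ t), ⟨mem_closedBall_zero_iff.2 hz, subset_closure ⟨t, rfl⟩⟩, rfl⟩
  have hQ0 : (0 : VolterraL1) ∈ Q := by
    simpa using hmem 0 0 (by simp)
  refine (isCompactOperator_iff_image_closedBall_subset_compact Dbar.toLinearMap one_pos).2
    ⟨VolterraL1.toMeasure '' Q, hQ.image VolterraL1.toMeasure.continuous, ?_⟩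
  rintro _ ⟨ν, hν, rfl⟩
  rw [mem_closedBall_zero_iff] at hν
  obtain ⟨k, hkm, hk1, hkν⟩ := ν.exists_polar
  obtain ⟨B, hB⟩ := hφtb.isBounded.exists_norm_le
  have hint : Integrable (fun t => k t • φ t) ν.variation := by
    refine Integrable.of_bound
      (hkm.aestronglyMeasurable.smul hφ.aestronglyMeasurable) B (Eventually.of_forall fun t => ?_)
    rw [norm_smul, hk1, one_mul]
    exact hB _ ⟨t, rfl⟩
  refine ⟨∫ t, k t • φ t ∂ν.variation, ?_, ?_⟩
  · rcases eq_or_ne ν.variation 0 with h0 | h0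
    · rw [h0, integral_zero_measure]
      exact hQ0
    · have : NeZero ν.variation := ⟨h0⟩
      rw [← measure_smul_average]
      refine hQc.smul_mem_of_zero_mem hQ0 (hQc.average_mem isClosed_closure
        (Eventually.of_forall fun t => hmem _ t (hk1 t).le) hint) ⟨measureReal_nonneg, ?_⟩
      rwa [ComplexMeasure.norm_eq] at hν
  · ext E hE : 1
    -- Evaluation on `E` is a bounded functional, so it passes under the Bochner integral.
    have h1 := ((ComplexMeasure.evalCLM E).comp
      VolterraL1.toMeasure.toContinuousLinearMap).integral_comp_comm hint
    have h2 : VolterraL1.toMeasure (∫ t, k t • φ t ∂ν.variation) E =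
        ∫ t, μ.weightedShift E t * k t ∂ν.variation := by
      refine h1.symm.trans (integral_congr_ae (Eventually.of_forall fun t => ?_))
      change VolterraL1.toMeasure (k t • φ t) E = _
      rw [map_smul]
      change k t * VolterraL1.toMeasure (φ t) E = _
      rw [hφE t E hE, mul_comm]
    rw [h2]
    change _ = Dbar ν E
    rw [(hD ν E hE).2]
    have h3 := ComplexMeasure.integral_withDensityᵥ_of_bounded hkm (fun x => (hk1 x).le)
      (hp.integrable_weightedShift hC hE ν.variation)
    rw [hkν] at h3
    exact h3.symm

end IsPolar

end LocalComplexMeasure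

/-- An operator is compact if its composition with an isometric embedding is compact. -/
theorem LinearIsometry.isCompactOperator_of_comp {E F G : Type*} [NormedAddCommGroup E]
    [NormedSpace ℂ E] [NormedAddCommGroup F] [NormedSpace ℂ F] [CompleteSpace F]
    [NormedAddCommGroup G] [NormedSpace ℂ G] (i : F →ₗᵢ[ℂ] G) {T : E →L[ℂ] F}
    (h : IsCompactOperator fun x => i (T x)) : IsCompactOperator T := by
  have hK := (isCompactOperator_iff_image_closedBall_subset_compact
    (i.toContinuousLinearMap.comp T).toLinearMap one_pos).1 h
  obtain ⟨K, hK, hsub⟩ := hK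
  refine (isCompactOperator_iff_image_closedBall_subset_compact T.toLinearMap one_pos).2
    ⟨closure (T '' Metric.closedBall 0 1), ?_, subset_closure⟩
  have htb : TotallyBounded (i '' (T '' Metric.closedBall 0 1)) := by
    refine hK.totallyBounded.subset ?_
    rintro _ ⟨_, ⟨x, hx, rfl⟩, rfl⟩
    exact hsub ⟨x, hx, rfl⟩
  exact ((totallyBounded_image_iff i.isometry.isUniformInducing).1 htb).closure.isCompact_of_isClosed
    isClosed_closure

/-! ### The equivalences -/

theorem mainTheorem1 (μ : LocalComplexMeasure) (hμ : μ.TailBounded) :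
    ∃ (D : VolterraL1 →L[ℂ] VolterraL1) (Dbar : VolterraM →L[ℂ] VolterraM),
      IsVolterraDerivation μ D ∧ IsVolterraMeasureDerivation μ Dbar ∧
      List.TFAE [
        IsCompactOperator D,
        IsWeaklyCompactOperator D,
        μ.IsAbsolutelyContinuous ∧ Tendsto μ.tailFun (𝓝[>] 0) (𝓝 0),
        IsCompactOperator Dbar,
        IsWeaklyCompactOperator Dbar] := by
  obtain ⟨m, h, hp⟩ := μ.exists_isPolar
  obtain ⟨C, hC⟩ := hp.exists_tail_bound hμ
  obtain ⟨Dbar, hDbar⟩ := hp.exists_measureDerivation hC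
  obtain ⟨D, hD, hDD⟩ := hp.exists_derivation hC hDbar
  -- Stated for maps from $L^1$ to $M$ so that one argument serves both (b), by embedding the range,
  -- and (e), by restricting the domain.
  have hweak : ∀ T : VolterraL1 →L[ℂ] VolterraM, (∀ f, T f = Dbar (VolterraL1.toMeasure f)) →
      IsWeaklyCompactOperator T →
      μ.IsAbsolutelyContinuous ∧ Tendsto μ.tailFun (𝓝[>] 0) (𝓝 0) := fun T hTD hT =>
    have key := fun (a : UnitIco) (ha : 0 < a) => hp.pointConv_mem_closure hC hDbar hDD hTD hT ha
    ⟨LocalComplexMeasure.IsPolar.isAbsolutelyContinuous_of_pointConv fun a ha => (key a ha).2,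
      hp.tendsto_tailFun_of_pointConv_mem hT fun a ha => (key a ha).1⟩
  refine ⟨D, Dbar, hD, hDbar, ?_⟩
  tfae_have 1 → 2 := fun h1 => h1.isWeaklyCompactOperator
  tfae_have 2 → 3 := fun h2 =>
    hweak _ (fun f => hDD f) (h2.clm_comp VolterraL1.toMeasure.toContinuousLinearMap)
  tfae_have 3 → 4 := fun h3 => hp.isCompactOperator_measureDerivation hC h3.1 h3.2 hDbar
  tfae_have 4 → 5 := fun h4 => h4.isWeaklyCompactOperator
  tfae_have 5 → 3 := fun h5 =>
    hweak _ (fun f => rfl) (h5.comp_clm (S := VolterraL1.toMeasure.toContinuousLinearMap)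
      VolterraL1.toMeasure.norm_toContinuousLinearMap_le)
  tfae_have 4 → 1 := fun h4 => by
    refine VolterraL1.toMeasure.isCompactOperator_of_comp ?_
    simp_rw [hDD]
    exact h4.comp_clm VolterraL1.toMeasure.toContinuousLinearMap
  tfae_finish
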